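/- Let $k,n$ be integers with $k\ge 1$ and $2k\le n$. Write $(x)_d=\prod_{i=0}^{d-1}(1-xq^i)$ and $\varphi(x)=\prod_{i\ge 0}(1-xq^i)$, the latter expanded as a power series in $x$ with coefficients in $\mathbb C(q)$; extend $\varphi$ multiplicatively to virtual characters by $\Phi(\sum_a \pm w_a)=\prod_a\varphi(w_a)^{\pm1}$ (common factors being cancelled). **Vertex functions.** Let $p$ be a torus fixed point of a Nakajima quiver variety with vertex set $I$, where $\hbar$ denotes the character of the symplectic form (the cotangent directions are scaled by $\hbar^{-1}$). Let $x_{i,j}$ $(1\le j\le \mathsf v_i)$ be the Chern roots of the tautological bundles $\mathcal V_i$ and $x_p$ their values (weights) at $p$; put $\mathcal P=\sum_{i\to j}\mathrm{Hom}(V_i,V_j)+\sum_i \mathrm{Hom}(W_i,V_i)-\sum_i\mathrm{Hom}(V_i,V_i)$. The vertex function at $p$ with descendant $\tau$ is the power series in the Kähler parameters $\boldsymbol z=(z_i)_{i\in I}$ $$\mathbf V_p(\boldsymbol z)\langle\tau\rangle=\sum_{d_{i,j}\ge 0}\Phi\big((q-\hbar)(\mathcal P(q^{\boldsymbol d}x_p)-\mathcal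 P(x_p))\big)\,\tau(q^{\boldsymbol d}x_p)\prod_{i,j}z_i^{d_{i,j}},$$ where $q^{\boldsymbol d}x_p$ has entries $q^{d_{i,j}}(x_p)_{i,j}$; we write $\mathbf V_p(\boldsymbol z)$ when $\tau=1$. An insertion that is a power series in a further variable is inserted coefficient by coefficient. **The two varieties.** Consider the quiver with vertices $1,\dots,n-1$, arrows $i\to i+1$, and dimension vector $\mathsf v_i=i$ for $i<k$, $\mathsf v_i=k$ for $k\le i\le n-k$, $\mathsf v_i=n-i$ for $i>n-k$; equivalently, $\mathsf v_i$ is the number of boxes $(a,b)$, $1\le a\le n-k$, $1\le b\le k$, of content $a-b+k=i$ in the Young diagram of $\lambda=(k,\dots,k)$ (of length $n-k$). The stability condition is that the image of the framing spaces $W_i$ generates $\bigoplus_i V_i$. Let $\hbar^!$ be the character of the symplectic form. * $X^!$ is the quiver variety with two one-dimensional framings, at the vertices $k$ and $n-k$, scaled by torus weights $u_1$ and $u_2$; put $u=u_1/u_2$. Let $p^!$ be the fixed point indexed by $\lambda$: $V_i$ is spanned by the boxes of content $i$, the framing at $k$ maps to the box $(1,1)$, and the box $(a,b)$ has weight $u_1(\hbar^!)^{b-1}$.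 Let $\mathbf V^!_{p^!}(u,\boldsymbol z)\in\mathbb C(q,\hbar^!,u)[[\boldsymbol z]]$ be the vertex function at $p^!$ (with $\tau=1$). * $X_\lambda$ (a point) is the quiver variety with one one-dimensional framing, at the vertex $k$, of weight $1$; the box $(a,b)$ has weight $(\hbar^!)^{b-1}$. Its vertex functions are denoted $\mathbf V_\lambda(\boldsymbol z)\langle\tau\rangle$, and $\boldsymbol x=(x_1,\dots,x_k)$ denotes the Chern roots of its tautological bundle $\mathcal V_{n-k}$. Let $P_{(d)}(\boldsymbol x;q,t)$ be the Macdonald polynomial for the one-row partition $(d)$: the symmetric function equal to $m_{(d)}$ plus a linear combination of the monomial symmetric functions $m_\mu$ with $\mu\vdash d$, $\mu\ne(d)$, and orthogonal to all these $m_\mu$ for Macdonald's scalar product $\langle p_\lambda,p_\mu\rangle=\delta_{\lambda\mu}\prod_{j}j^{m_j}m_j!\prod_i\frac{1-q^{\lambda_i}}{1-t^{\lambda_i}}$ ($m_j$ the number of parts of $\lambda$ equal to $j$), evaluated in the variables $\boldsymbol x$. **Proposition.** The expansion of $\mathbf V^!_{p^!}(u,\boldsymbol z)$ in powers of $u$ lies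 in $\mathbb C(q,\hbar^!)[[\boldsymbol z,u]]$, and there $$\mathbf V^!_{p^!}(u,\boldsymbol z)=\prod_{i=1}^k\frac{\varphi(u(\hbar^!)^i)}{\varphi(uq(\hbar^!)^{i-1})}\;\mathbf V_\lambda(\boldsymbol z)\Big\langle\sum_{d=0}^\infty\frac{(q/\hbar^!)_d}{(q)_d}\,P_{(d)}(\boldsymbol x;q,q/\hbar^!)\,(\hbar^!u)^d\Big\rangle .$$ -/

import Mathlib

open Finset

noncomputable section

namespace QuiverVertex

/-! ### q-Pochhammer symbols and the function `φ` -/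

/-- The finite `q`-Pochhammer symbol `(x)_n = ∏_{i<n} (1 - x q^i)`. -/
def qPoch {K : Type} [Field K] (q x : K) (n : ℕ) : K := ∏ i ∈ range n, (1 - x * q ^ i)

/-- `φ(x) = ∏_{i ≥ 0} (1 - x q^i)` expanded as a power series in `x` whose coefficients are
rational functions of `q`. The theorem `tendsto_coeff_prod` below shows that this is the limit of
the partial products, coefficient by coefficient. -/
def qPhi {K : Type} [Field K] (q : K) : PowerSeries K :=
  PowerSeries.mk fun n => (-1) ^ n * q ^ (n.choose 2) / qPoch q q n

theorem coeff_prod_succ {K : Type} [Field K] (q : K) (N n : ℕ) :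
    (1 - q ^ (n + 1)) *
        PowerSeries.coeff (n + 1) (∏ i ∈ range N, (1 - PowerSeries.C (q ^ i) * PowerSeries.X)) =
      (q ^ N - q ^ n) *
        PowerSeries.coeff n (∏ i ∈ range N, (1 - PowerSeries.C (q ^ i) * PowerSeries.X)) := by
  have key : (1 - PowerSeries.X) * PowerSeries.rescale q
        (∏ i ∈ range N, (1 - PowerSeries.C (q ^ i) * PowerSeries.X)) =
      (∏ i ∈ range N, (1 - PowerSeries.C (q ^ i) * PowerSeries.X)) *
        (1 - PowerSeries.C (q ^ N) * PowerSeries.X) := by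
    rw [← prod_range_succ, prod_range_succ', map_prod, mul_comm]
    congr 1
    · refine prod_congr rfl fun i _ => ?_
      simp only [map_sub, map_one, map_mul, PowerSeries.rescale_X]
      rw [pow_succ, map_mul]
      have : PowerSeries.rescale q (PowerSeries.C (q ^ i)) = PowerSeries.C (q ^ i) := by
        ext m
        simp only [PowerSeries.coeff_rescale, PowerSeries.coeff_C]
        split_ifs with h
        · simp [h]
        · simp
      rw [this]
      ring
    · simp
  have h := congrArg (PowerSeries.coeff (n + 1)) key
  rw [sub_mul, mul_sub, one_mul, mul_one, map_sub, map_sub, mul_comm _ (PowerSeries.C _ * _),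
    mul_assoc, PowerSeries.coeff_C_mul, PowerSeries.coeff_succ_X_mul, PowerSeries.coeff_succ_X_mul,
    PowerSeries.coeff_rescale, PowerSeries.coeff_rescale] at h
  linear_combination -h

/-- `qPhi q` is the infinite product `∏_{i ≥ 0} (1 - x q^i)`, in every topological ring structure
in which `q^N → 0` (for instance over `ℂ` for `|q| < 1`, or `q`-adically). -/
theorem tendsto_coeff_prod {K : Type} [Field K] [TopologicalSpace K] [IsTopologicalRing K] (q : K)
    (hq : Filter.Tendsto (fun N : ℕ => q ^ N) Filter.atTop (nhds 0))
    (hne : ∀ j : ℕ, q ^ (j + 1) ≠ 1) (n : ℕ) :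
    Filter.Tendsto (fun N : ℕ => PowerSeries.coeff n
        (∏ i ∈ range N, (1 - PowerSeries.C (q ^ i) * PowerSeries.X)))
      Filter.atTop (nhds (PowerSeries.coeff n (qPhi q))) := by
  induction n with
  | zero =>
    have : ∀ N : ℕ, PowerSeries.coeff 0
        (∏ i ∈ range N, (1 - PowerSeries.C (q ^ i) * PowerSeries.X)) = 1 := by
      intro N
      simp [map_prod]
    simp only [this]
    simpa [qPhi, qPoch] using tendsto_const_nhds
  | succ n ih =>
    have h1 : (1 - q ^ (n + 1)) ≠ 0 := sub_ne_zero.mpr (hne n).symm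
    have e1 : (fun N : ℕ => PowerSeries.coeff (n + 1)
        (∏ i ∈ range N, (1 - PowerSeries.C (q ^ i) * PowerSeries.X))) =
        fun N : ℕ => (1 - q ^ (n + 1))⁻¹ * ((q ^ N - q ^ n) * PowerSeries.coeff n
        (∏ i ∈ range N, (1 - PowerSeries.C (q ^ i) * PowerSeries.X))) := by
      funext N
      rw [← coeff_prod_succ, inv_mul_cancel_left₀ h1]
    have e2 : PowerSeries.coeff (n + 1) (qPhi q) =
        (1 - q ^ (n + 1))⁻¹ * ((0 - q ^ n) * PowerSeries.coeff n (qPhi q)) := by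
      simp only [qPhi, PowerSeries.coeff_mk, qPoch, prod_range_succ]
      rw [Nat.choose_succ_succ' n 1, Nat.choose_one_right]
      have : (1 - q * q ^ n) = 1 - q ^ (n + 1) := by ring
      rw [this, div_eq_mul_inv, mul_inv, div_eq_mul_inv]
      ring
    rw [e1, e2]
    exact ((hq.sub_const _).mul ih).const_mul _

/-! ### Virtual characters and `Φ`

A torus character is a unit of a field `F` that contains the torus coordinates; virtual characters
are elements of the group ring `ℤ[Fˣ]`. -/

/-- The multiplicative extension `Φ(∑ ± x) = ∏ φ(x)^{±1}`, where `φ(x) = ∏_{i ≥ 0} (1 - x q^i)`: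
the factor `1 - w` occurs in `Φ(χ)` with multiplicity `∑_{i ≥ 0} χ(w q^{-i})`. It is used only for
those `χ` for which all but finitely many factors cancel, so that `Φ(χ)` is a finite product. -/
def Phi {F : Type} [Field F] (q : Fˣ) (χ : MonoidAlgebra ℤ Fˣ) : F :=
  ∏ᶠ w : Fˣ, (1 - (w : F)) ^ (∑ᶠ i : ℕ, χ.coeff (w / q ^ i))

/-- The character `w`, as an element of the ring of virtual characters. -/
def chr {F : Type} [Field F] (w : Fˣ) : MonoidAlgebra ℤ Fˣ := MonoidAlgebra.single w 1

/-! ### Torus fixed points of Nakajima quiver varieties -/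

/-- A torus fixed point of the Nakajima quiver variety of the quiver with vertices `I` and arrows
`E`. The spaces `V = ⨁ V_i` and `W = ⨁ W_i` are given by bases `R` and `S` of homogeneous weight
vectors. The point is represented by a stable zero `(X, Y, A, B)` of the moment map, and it is
fixed because the torus action (in which the cotangent directions `Y`, `B` are scaled by
`ħ⁻¹`) is compensated by the action on `V` with weights `x`. So the tautological bundle
`𝒱_i` has character `∑ x_r` at this point, the sum over `r` at vertex `i`. -/
structure FixedPoint {I E : Type} [Fintype E] (src tgt : E → I) (F : Type) [Field F] (ħ : Fˣ)
    (R S : Type) [Fintype R] [Fintype S] where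
  /-- the vertex at which a basis vector of `V` sits -/
  vtx : R → I
  /-- the vertex at which a basis vector of `W` sits -/
  fr : S → I
  /-- torus weights of `V` -/
  x : R → Fˣ
  /-- torus weights of `W` -/
  a : S → Fˣ
  /-- the maps `V_{src e} → V_{tgt e}` -/
  X : E → Matrix R R ℂ
  /-- the maps `V_{tgt e} → V_{src e}` -/
  Y : E → Matrix R R ℂ
  /-- the maps `W_i → V_i` -/
  A : Matrix R S ℂ
  /-- the maps `V_i → W_i` -/
  B : Matrix S R ℂ
  X_fixed : ∀ e r' r, X e r' r ≠ 0 → vtx r = src e ∧ vtx r' = tgt e ∧ x r' = x r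
  Y_fixed : ∀ e r' r, Y e r' r ≠ 0 → vtx r = tgt e ∧ vtx r' = src e ∧ x r' = ħ * x r
  A_fixed : ∀ r s, A r s ≠ 0 → vtx r = fr s ∧ x r = a s
  B_fixed : ∀ s r, B s r ≠ 0 → vtx r = fr s ∧ a s = ħ * x r
  /-- the moment map vanishes (the blocks of this matrix are its components at the vertices) -/
  moment : ∑ e, (X e * Y e - Y e * X e) + A * B = 0
  /-- the image of `A` generates `V` under all `X_e`, `Y_e` -/
  stable : ∀ N : Submodule ℂ (R → ℂ),
    (∀ v, A.mulVec v ∈ N) → (∀ e, ∀ v ∈ N, (X e).mulVec v ∈ N) →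
    (∀ e, ∀ v ∈ N, (Y e).mulVec v ∈ N) → N = ⊤

namespace FixedPoint

variable {I E : Type} [Fintype E] {src tgt : E → I} {F : Type} [Field F] {ħ : Fˣ}
  {R S : Type} [Fintype R] [Fintype S]

open Classical in
/-- The virtual character of
`𝒫 = ∑_{i → j} Hom(V_i, V_j) + ∑_i Hom(W_i, V_i) - ∑_i Hom(V_i, V_i)` in terms of the Chern
roots `y` of the bundles `V_i`. -/
def polarization (p : FixedPoint src tgt F ħ R S) (y : R → Fˣ) : MonoidAlgebra ℤ Fˣ :=
  (∑ e : E, ∑ r : R, ∑ r' : R,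
    if p.vtx r = src e ∧ p.vtx r' = tgt e then chr (y r' / y r) else 0) +
  (∑ s : S, ∑ r : R, if p.vtx r = p.fr s then chr (y r / p.a s) else 0) -
  (∑ r : R, ∑ r' : R, if p.vtx r = p.vtx r' then chr (y r' / y r) else 0)

/-- The Chern roots at the fixed point, shifted by `q^d`. -/
def shift (p : FixedPoint src tgt F ħ R S) (q : Fˣ) (d : R → ℕ) : R → Fˣ :=
  fun r => q ^ d r * p.x r

open Classical in
/-- The vertex function at the fixed point `p` with descendant `τ`, that is the power series in
the Kähler parameters `z_i` given by the `q`-integral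
`Φ((q-ħ)𝒫_p)⁻¹ f(x_p,z)⁻¹ ∑_d Φ((q-ħ)𝒫(q^d x_p)) f(q^d x_p,z) τ(q^d x_p)`.
Here `f(q^d x_p,z) / f(x_p,z) = ∏ z_{vtx r}^{d_r}`, so the coefficient of `z^m` is the sum over
those `d` for which the `d_r` with `r` at vertex `i` add up to `m_i`, for each `i`. The values of
`τ` may lie in any algebra over `F`, such as a ring of power series over `F`. -/
def vertexFunction (p : FixedPoint src tgt F ħ R S) (q : Fˣ) {T : Type} [CommRing T] [Algebra F T]
    (τ : (R → Fˣ) → T) : MvPowerSeries I T := fun m =>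
  ∑ d ∈ (Fintype.piFinset fun r : R => range (m (p.vtx r) + 1)) with
      (∀ i : I, ∑ r : R with p.vtx r = i, d r = m i),
    Phi q ((chr q - chr ħ) * (p.polarization (p.shift q d) - p.polarization p.x)) •
      τ (p.shift q d)

end FixedPoint

/-! ### The quiver `A_{n-1}` and the fixed points attached to the rectangle `(k^{n-k})` -/

/-- The vertices `1, …, n-1`. -/
abbrev Vertex (n : ℕ) : Type := Finset.Icc 1 (n - 1)

/-- The arrows `i → i+1`. -/
abbrev Arrow (n : ℕ) : Type := {e : Vertex n × Vertex n // (e.1 : ℕ) + 1 = e.2}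

/-- The boxes of the Young diagram of `λ = (k, …, k)`, of length `n-k`. The box with coordinates
`(i, j)`, `1 ≤ i ≤ n-k`, `1 ≤ j ≤ k`, is the pair `(i-1, j-1)`. -/
abbrev Box (k n : ℕ) : Type := Fin (n - k) × Fin k

/-- The content `i - j + λ_1` of a box `(i, j)`. -/
def content {k n : ℕ} (r : Box k n) : Vertex n :=
  ⟨r.1 + k - r.2, by
    have h1 := r.1.2
    have h2 := r.2.2
    simp only [Finset.mem_Icc]
    omega⟩

/-- The dimension vector: `i` for `i < k`, then `k`, then `n - i` for `i > n-k`. -/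
theorem card_content {k n : ℕ} (hkn : 2 * k ≤ n) (i : Vertex n) :
    Fintype.card {r : Box k n // content r = i} =
      if (i : ℕ) < k then (i : ℕ) else if (i : ℕ) ≤ n - k then k else n - i := by
  have hi := Finset.mem_Icc.mp i.2
  have : Fintype.card {r : Box k n // content r = i} =
      (Finset.Ico (k - (i : ℕ)) (min k (n - i))).card := by
    rw [← Fintype.card_coe]
    refine Fintype.card_congr
      { toFun := fun r => ⟨r.1.2, ?_⟩
        invFun := fun b => ⟨(⟨i + b - k, ?_⟩, ⟨b, ?_⟩), ?_⟩
        left_inv := ?_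
        right_inv := ?_ }
    · have h := congrArg Subtype.val r.2
      have h1 := r.1.1.2
      have h2 := r.1.2.2
      simp only [content] at h
      simp only [Finset.mem_Ico, lt_min_iff]
      omega
    · have hb := Finset.mem_Ico.mp b.2
      rw [lt_min_iff] at hb
      omega
    · have hb := Finset.mem_Ico.mp b.2
      rw [lt_min_iff] at hb
      omega
    · have hb := Finset.mem_Ico.mp b.2
      rw [lt_min_iff] at hb
      apply Subtype.ext
      simp only [content]
      omega
    · rintro ⟨r, hr⟩
      have h := congrArg Subtype.val hr
      have h1 := r.1.2
      have h2 := r.2.2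
      simp only [content] at h
      apply Subtype.ext
      apply Prod.ext
      · apply Fin.ext
        simp only
        omega
      · rfl
    · intro b
      rfl
  rw [this, Nat.card_Ico]
  split_ifs <;> omega

open Classical in
/-- The matrices of the fixed point: `X` maps the box `(i, j)` to `(i+1, j)`. -/
def boxX {k n : ℕ} (e : Arrow n) : Matrix (Box k n) (Box k n) ℂ := fun r' r =>
  if content r = e.1.1 ∧ (r'.1 : ℕ) = r.1 + 1 ∧ r'.2 = r.2 then 1 else 0

open Classical in
/-- The matrices of the fixed point: `Y` maps the box `(i, j)` to `(i, j+1)`. -/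
def boxY {k n : ℕ} (e : Arrow n) : Matrix (Box k n) (Box k n) ℂ := fun r' r =>
  if content r = e.1.2 ∧ r'.1 = r.1 ∧ (r'.2 : ℕ) = r.2 + 1 then 1 else 0

open Classical in
/-- The framing vector `s₀` is mapped to the corner box `(1, 1)`. -/
def boxA {k n : ℕ} {S : Type} (s₀ : S) : Matrix (Box k n) S ℂ := fun r s =>
  if s = s₀ ∧ (r.1 : ℕ) = 0 ∧ (r.2 : ℕ) = 0 then 1 else 0

theorem boxXY {k n : ℕ} (r' r : Box k n) :
    ∑ e : Arrow n, (boxX e * boxY e : Matrix (Box k n) (Box k n) ℂ) r' r =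
      if (r'.1 : ℕ) = r.1 + 1 ∧ (r'.2 : ℕ) = r.2 + 1 then 1 else 0 := by
  have hr := r.1.2
  have hr2 := r.2.2
  have hr' := r'.1.2
  have hr2' := r'.2.2
  simp only [Matrix.mul_apply, boxX, boxY, ← ite_and, mul_ite, mul_one, mul_zero]
  split_ifs with h
  · set m : Box k n := (r.1, r'.2) with hm
    have hmr : (content m : ℕ) + 1 = content r := by
      simp only [content, hm]
      omega
    rw [Fintype.sum_eq_single ⟨(content m, content r), hmr⟩, Fintype.sum_eq_single m]
    · rw [if_pos]
      exact ⟨⟨rfl, rfl, h.2⟩, rfl, h.1, rfl⟩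
    · intro m' hm'
      rw [if_neg]
      rintro ⟨⟨-, h1, -⟩, -, -, h2⟩
      exact hm' (Prod.ext h1 h2.symm)
    · intro e he
      refine Finset.sum_eq_zero fun m' _ => if_neg ?_
      rintro ⟨⟨h0, h1, -⟩, h3, -, h2⟩
      have : m' = m := Prod.ext h1 h2.symm
      subst this
      exact he (Subtype.ext (Prod.ext h3.symm h0.symm))
  · refine Finset.sum_eq_zero fun e _ => Finset.sum_eq_zero fun m _ => if_neg ?_
    rintro ⟨⟨-, h1, h2⟩, -, h3, h4⟩
    exact h ⟨by rw [h3, h1], by rw [h4, h2]⟩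

theorem boxYX {k n : ℕ} (r' r : Box k n) :
    ∑ e : Arrow n, (boxY e * boxX e : Matrix (Box k n) (Box k n) ℂ) r' r =
      if (r'.1 : ℕ) = r.1 + 1 ∧ (r'.2 : ℕ) = r.2 + 1 then 1 else 0 := by
  have hr := r.1.2
  have hr2 := r.2.2
  have hr' := r'.1.2
  have hr2' := r'.2.2
  simp only [Matrix.mul_apply, boxX, boxY, ← ite_and, mul_ite, mul_one, mul_zero]
  split_ifs with h
  · set m : Box k n := (r'.1, r.2) with hm
    have hmr : (content r : ℕ) + 1 = content m := by
      simp only [content, hm]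
      omega
    rw [Fintype.sum_eq_single ⟨(content r, content m), hmr⟩, Fintype.sum_eq_single m]
    · rw [if_pos]
      exact ⟨⟨rfl, h.1, rfl⟩, rfl, rfl, h.2⟩
    · intro m' hm'
      rw [if_neg]
      rintro ⟨⟨-, -, h1⟩, -, h2, -⟩
      exact hm' (Prod.ext h2.symm h1)
    · intro e he
      refine Finset.sum_eq_zero fun m' _ => if_neg ?_
      rintro ⟨⟨h0, -, h1⟩, h3, h2, -⟩
      have : m' = m := Prod.ext h2.symm h1
      subst this
      exact he (Subtype.ext (Prod.ext h0.symm h3.symm))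
  · refine Finset.sum_eq_zero fun e _ => Finset.sum_eq_zero fun m _ => if_neg ?_
    rintro ⟨⟨-, h1, h2⟩, -, h3, h4⟩
    exact h ⟨by rw [h3, h1], by rw [h4, h2]⟩

/-- The torus fixed point attached to the rectangle, for a framing `fr` with weights `a` in which
`s₀` is a framing vector at vertex `k`: the spaces `V_i` are spanned by the boxes of content `i`,
and the box `(i, j)` has weight `a_{s₀} ħ^{j-1}`. -/
def rectanglePoint {k n : ℕ} (F : Type) [Field F] (ħ : Fˣ) {S : Type} [Fintype S]
    (fr : S → Vertex n) (a : S → Fˣ) (s₀ : S) (h₀ : (fr s₀ : ℕ) = k) :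
    FixedPoint (fun e : Arrow n => e.1.1) (fun e : Arrow n => e.1.2) F ħ (Box k n) S where
  vtx := content
  fr := fr
  x := fun r => a s₀ * ħ ^ (r.2 : ℕ)
  a := a
  X := boxX
  Y := boxY
  A := boxA s₀
  B := 0
  X_fixed := by
    intro e r' r h
    have h' : content r = e.1.1 ∧ (r'.1 : ℕ) = r.1 + 1 ∧ r'.2 = r.2 := by
      by_contra hc
      exact h (if_neg hc)
    obtain ⟨h1, h2, h3⟩ := h'
    refine ⟨h1, Subtype.ext ?_, by rw [h3]⟩
    rw [← e.2, ← h1]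
    have := r.2.2
    simp only [content, h2, h3]
    omega
  Y_fixed := by
    intro e r' r h
    have h' : content r = e.1.2 ∧ r'.1 = r.1 ∧ (r'.2 : ℕ) = r.2 + 1 := by
      by_contra hc
      exact h (if_neg hc)
    obtain ⟨h1, h2, h3⟩ := h'
    refine ⟨h1, Subtype.ext ?_, by rw [h3, pow_succ, mul_comm ħ, mul_assoc]⟩
    have h4 := e.2
    rw [← h1] at h4
    have := r.2.2
    have := r'.2.2
    simp only [content] at h4 ⊢
    rw [h2]
    omega
  A_fixed := by
    intro r s h
    have h' : s = s₀ ∧ (r.1 : ℕ) = 0 ∧ (r.2 : ℕ) = 0 := by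
      by_contra hc
      exact h (if_neg hc)
    obtain ⟨rfl, h2, h3⟩ := h'
    refine ⟨Subtype.ext ?_, by rw [h3, pow_zero, mul_one]⟩
    simp only [content]
    omega
  B_fixed := by
    intro s r h
    exact absurd rfl h
  moment := by
    ext r' r
    rw [Matrix.mul_zero, add_zero, Matrix.sum_apply]
    simp only [Matrix.sub_apply, Finset.sum_sub_distrib]
    rw [boxXY, boxYX, sub_self, Matrix.zero_apply]
  stable := by
    intro N hA hX hY
    classical
    have hcol0 : ∀ r : Box k n, (r.1 : ℕ) = 0 → (r.2 : ℕ) = 0 → Pi.single r (1 : ℂ) ∈ N := by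
      intro r h1 h2
      have h := hA (Pi.single s₀ 1)
      rw [Matrix.mulVec_single_one] at h
      convert h using 1
      funext r'
      simp only [Pi.single_apply, Matrix.col_apply, boxA]
      refine if_congr ?_ rfl rfl
      constructor
      · rintro rfl
        exact ⟨trivial, h1, h2⟩
      · rintro ⟨-, h3, h4⟩
        exact Prod.ext (Fin.ext (by omega)) (Fin.ext (by omega))
    have hcol : ∀ j : ℕ, ∀ r : Box k n, (r.1 : ℕ) = 0 → (r.2 : ℕ) = j →
        Pi.single r (1 : ℂ) ∈ N := by
      intro j
      induction j with
      | zero => exact hcol0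
      | succ j ih =>
        intro r h1 h2
        have hr1 := r.1.2
        have hr2 := r.2.2
        set m : Box k n := (r.1, ⟨j, by omega⟩) with hm
        have hmr : (content r : ℕ) + 1 = content m := by
          simp only [content, hm]
          omega
        have h := hY ⟨(content r, content m), hmr⟩ _ (ih m h1 rfl)
        rw [Matrix.mulVec_single_one] at h
        convert h using 1
        funext r'
        simp only [Pi.single_apply, Matrix.col_apply, boxY]
        refine if_congr ?_ rfl rfl
        constructor
        · rintro rfl
          exact ⟨trivial, rfl, h2⟩
        · rintro ⟨-, h3, h4⟩
          exact Prod.ext h3 (Fin.ext (by rw [h4, h2]))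
    have hall : ∀ i : ℕ, ∀ r : Box k n, (r.1 : ℕ) = i → Pi.single r (1 : ℂ) ∈ N := by
      intro i
      induction i with
      | zero => exact fun r h => hcol _ r h rfl
      | succ i ih =>
        intro r h1
        have hr1 := r.1.2
        have hr2 := r.2.2
        set m : Box k n := (⟨i, by omega⟩, r.2) with hm
        have hmr : (content m : ℕ) + 1 = content r := by
          simp only [content, hm]
          omega
        have h := hX ⟨(content m, content r), hmr⟩ _ (ih m rfl)
        rw [Matrix.mulVec_single_one] at h
        convert h using 1
        funext r'
        simp only [Pi.single_apply, Matrix.col_apply, boxX]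
        refine if_congr ?_ rfl rfl
        constructor
        · rintro rfl
          exact ⟨trivial, h1, rfl⟩
        · rintro ⟨-, h3, h4⟩
          exact Prod.ext (Fin.ext (by rw [h3, h1])) h4
    rw [eq_top_iff]
    intro v _
    rw [pi_eq_sum_univ' v]
    refine N.sum_mem fun r _ => N.smul_mem _ ?_
    convert hall _ r rfl using 1

/-! ### Macdonald polynomials -/

section Macdonald

variable {K : Type} [Field K]

/-- The symmetric function `∑_ν a_ν p_ν` of degree `d`, in the variables `σ`. Since the power sum
products `p_ν` are a basis of the symmetric functions of degree `d` (in infinitely many variables,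
or in `d` variables) over a field of characteristic zero, the symmetric functions of degree `d` are
given by their coordinates `a`. -/
def symFun (σ : Type) [Fintype σ] {d : ℕ} (a : Nat.Partition d → K) : MvPolynomial σ K :=
  ∑ ν, MvPolynomial.C (a ν) * MvPolynomial.psumPart σ K ν

/-- Macdonald's scalar product,
`⟨p_ν, p_ν'⟩ = δ_{ν ν'} ∏_j j^{m_j} m_j! ∏_i (1 - q^{ν_i}) / (1 - t^{ν_i})`,
with `m_j` the number of parts of `ν` equal to `j`. -/
def macInner (q t : K) {d : ℕ} (a b : Nat.Partition d → K) : K :=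
  ∑ ν : Nat.Partition d, a ν * b ν *
    ((∏ j ∈ ν.parts.toFinset, ((j ^ ν.parts.count j * (ν.parts.count j).factorial : ℕ) : K)) *
      (ν.parts.map fun j => (1 - q ^ j) / (1 - t ^ j)).prod)

/-- The dominance order on partitions of `d`. -/
def Dominated {d : ℕ} (μ ν : Nat.Partition d) : Prop :=
  ∀ i : ℕ, ((μ.parts.sort (· ≥ ·)).take i).sum ≤ ((ν.parts.sort (· ≥ ·)).take i).sum

/-- The symmetric function with coordinates `a` is a linear combination `∑ c_μ m_μ` of monomial
symmetric functions. An identity of symmetric functions of degree `d` may be checked in `d`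
variables. -/
def HasMonomialExpansion {d : ℕ} (a c : Nat.Partition d → K) : Prop :=
  symFun (Fin d) a = ∑ μ, MvPolynomial.C (c μ) * MvPolynomial.msymm (Fin d) K μ

/-- `a` is the Macdonald symmetric function `P_ν(q,t)`: it is `m_ν` plus a linear combination of
the `m_μ` with `μ < ν` in the dominance order, and it is orthogonal to all `m_μ` with `μ < ν`
(equivalently, to all `P_μ` with `μ < ν`, which have the same span). -/
def IsMacdonald (q t : K) {d : ℕ} (ν : Nat.Partition d) (a : Nat.Partition d → K) : Prop :=
  (∃ c : Nat.Partition d → K, HasMonomialExpansion a c ∧ c ν = 1 ∧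
    ∀ μ, c μ ≠ 0 → Dominated μ ν) ∧
  ∀ b c : Nat.Partition d → K, HasMonomialExpansion b c →
    (∀ μ, c μ ≠ 0 → Dominated μ ν ∧ μ ≠ ν) → macInner q t a b = 0

open Classical in
/-- The Macdonald polynomial `P_ν(x; q, t)` in the variables `σ`. -/
def macdonaldP (q t : K) {d : ℕ} (ν : Nat.Partition d) (σ : Type) [Fintype σ] :
    MvPolynomial σ K :=
  if h : ∃ a : Nat.Partition d → K, IsMacdonald q t ν a then symFun σ h.choose else 0

end Macdonald

/-! ### The coefficient fields and the two vertex functions -/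

/-- The field `ℂ(q, ħ)`. -/
def Cqh : Type := FractionRing (MvPolynomial (Fin 2) ℂ)

instance : Field Cqh := inferInstanceAs (Field (FractionRing (MvPolynomial (Fin 2) ℂ)))

instance : Algebra (MvPolynomial (Fin 2) ℂ) Cqh :=
  inferInstanceAs (Algebra _ (FractionRing (MvPolynomial (Fin 2) ℂ)))

instance : IsFractionRing (MvPolynomial (Fin 2) ℂ) Cqh :=
  inferInstanceAs (IsFractionRing _ (FractionRing (MvPolynomial (Fin 2) ℂ)))

/-- The element `q`. -/
def qq : Cqhˣ := Units.mk0 (algebraMap (MvPolynomial (Fin 2) ℂ) Cqh (MvPolynomial.X 0)) (by simp)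

/-- The element `ħ`. -/
def hh : Cqhˣ := Units.mk0 (algebraMap (MvPolynomial (Fin 2) ℂ) Cqh (MvPolynomial.X 1)) (by simp)

/-- The field `ℂ(q, ħ, u)`. -/
abbrev Cqhu : Type := RatFunc Cqh

/-- The elements of `ℂ(q, ħ)ˣ` in `ℂ(q, ħ, u)ˣ`. -/
abbrev liftU : Cqhˣ →* Cqhuˣ := Units.map (algebraMap Cqh Cqhu : Cqh →* Cqhu)

/-- The element `u = u₁ / u₂`. -/
def uu : Cqhuˣ := Units.mk0 RatFunc.X RatFunc.X_ne_zero

section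

variable (k n : ℕ) (hk : 1 ≤ k) (hkn : 2 * k ≤ n)

/-- The vertex `k`. -/
def vertexK : Vertex n := ⟨k, Finset.mem_Icc.mpr (by omega)⟩

/-- The vertex `n-k`. -/
def vertexNK : Vertex n := ⟨n - k, Finset.mem_Icc.mpr (by omega)⟩

/-- The fixed point `p^!` of `X^!`. There are two framings, at `k` and at `n-k`, with weights
`u₁` and `u₂`; everything depends on `u = u₁ / u₂` only, and the weights are normalized to
`u₁ = u`, `u₂ = 1`. -/
def dualPoint : FixedPoint (fun e : Arrow n => e.1.1) (fun e : Arrow n => e.1.2)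
    Cqhu (liftU hh) (Box k n) (Fin 2) :=
  rectanglePoint Cqhu (liftU hh) ![vertexK k n hk hkn, vertexNK k n hk hkn] ![uu, 1] 0 rfl

/-- The point `X_λ`, with its single framing at `k = λ_1`, of weight one. -/
def lambdaPoint : FixedPoint (fun e : Arrow n => e.1.1) (fun e : Arrow n => e.1.2)
    Cqh hh (Box k n) Unit :=
  rectanglePoint Cqh hh (fun _ => vertexK k n hk hkn) (fun _ => 1) () rfl

/-- The vertex function of `X^!` at `p^!`, in `ℂ(q, ħ, u)[[z]]`. -/
def dualVertex : MvPowerSeries (Vertex n) Cqhu :=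
  (dualPoint k n hk hkn).vertexFunction (liftU qq) (fun _ => (1 : Cqhu))

/-- The descendant `∑_d (q/ħ)_d / (q)_d P_{(d)}(x; q, q/ħ) (ħ u)^d`, a power series in `u` whose
coefficients are symmetric polynomials in the Chern roots `x` of `𝒱_{n-k}`. -/
def descendant (x : Box k n → Cqhˣ) : PowerSeries Cqh :=
  PowerSeries.mk fun d =>
    qPoch (qq : Cqh) (qq / hh) d / qPoch (qq : Cqh) qq d *
      MvPolynomial.eval
        (fun r : {r : Box k n // content r = vertexNK k n hk hkn} => (x r.1 : Cqh))
        (macdonaldP (qq : Cqh) (qq / hh) (Nat.Partition.indiscrete d)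
          {r : Box k n // content r = vertexNK k n hk hkn}) *
      (hh : Cqh) ^ d

/-- The descendant vertex function of `X_λ`, in `ℂ(q, ħ)[[u]][[z]] = ℂ(q, ħ)[[z, u]]`; the
insertion of a power series in `u` is the power series of the insertions of its coefficients. -/
def lambdaVertex : MvPowerSeries (Vertex n) (PowerSeries Cqh) :=
  (lambdaPoint k n hk hkn).vertexFunction qq (descendant k n hk hkn)

/-- `φ(c u)` as a power series in `u`. -/
def phiU (c : Cqh) : PowerSeries Cqh := PowerSeries.rescale c (qPhi (qq : Cqh))

/-- `∏_{i=1}^k φ(u ħ^i) / φ(u q ħ^{i-1})`. -/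
def prefactor : PowerSeries Cqh :=
  ∏ i ∈ Finset.Icc 1 k, phiU ((hh : Cqh) ^ i) * (phiU ((qq : Cqh) * (hh : Cqh) ^ (i - 1)))⁻¹

end

open scoped RatFunc in
/-- Expansion of rational functions as Laurent series in `u`. -/
def expandU : Cqhu →+* LaurentSeries Cqh := algebraMap Cqhu (LaurentSeries Cqh)

end QuiverVertex

end

open QuiverVertex

noncomputable section

namespace QuiverVertex

/-! ### Multiplicities of the factors of `Φ` -/

section Phi

variable {F : Type} [Field F] {q : Fˣ}

/-- The multiplicity of the factor `1 - w` in `Φ(χ)`. -/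
def charMult (q : Fˣ) (χ : MonoidAlgebra ℤ Fˣ) (w : Fˣ) : ℤ := ∑ᶠ i : ℕ, χ.coeff (w / q ^ i)

theorem Phi_eq_finprod (q : Fˣ) (χ : MonoidAlgebra ℤ Fˣ) :
    Phi q χ = ∏ᶠ w : Fˣ, (1 - (w : F)) ^ charMult q χ w := rfl

theorem finite_support_coeff_div (hq : Function.Injective fun i : ℕ => q ^ i)
    (χ : MonoidAlgebra ℤ Fˣ) (w : Fˣ) :
    (Function.support fun i : ℕ => χ.coeff (w / q ^ i)).Finite := by
  refine Set.Finite.of_finite_image (f := fun i : ℕ => w / q ^ i)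
    (χ.coeff.support.finite_toSet.subset ?_) ?_
  · rintro _ ⟨i, hi, rfl⟩
    simpa using hi
  · intro i _ j _ hij
    exact hq (div_right_injective hij)

theorem charMult_zero (w : Fˣ) : charMult q 0 w = 0 := by
  simp [charMult]

theorem charMult_add (hq : Function.Injective fun i : ℕ => q ^ i) (χ ψ : MonoidAlgebra ℤ Fˣ)
    (w : Fˣ) : charMult q (χ + ψ) w = charMult q χ w + charMult q ψ w := by
  simp only [charMult, MonoidAlgebra.coeff_add, Finsupp.add_apply]
  exact finsum_add_distrib (finite_support_coeff_div hq χ w) (finite_support_coeff_div hq ψ w)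

theorem charMult_neg (χ : MonoidAlgebra ℤ Fˣ) (w : Fˣ) :
    charMult q (-χ) w = -charMult q χ w := by
  simp only [charMult, MonoidAlgebra.coeff_neg, Finsupp.neg_apply]
  exact finsum_neg_distrib _

theorem coeff_chr_mul (v : Fˣ) (χ : MonoidAlgebra ℤ Fˣ) (w : Fˣ) :
    (chr v * χ).coeff w = χ.coeff (v⁻¹ * w) := by
  rw [chr, MonoidAlgebra.coeff_single_mul_eq_mul_coeff (v⁻¹ * w), one_mul]
  intro m _
  rw [eq_inv_mul_iff_mul_eq]

theorem charMult_chr_mul (v : Fˣ) (χ : MonoidAlgebra ℤ Fˣ) (w : Fˣ) :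
    charMult q (chr v * χ) w = charMult q χ (v⁻¹ * w) := by
  simp only [charMult, coeff_chr_mul, mul_div_assoc]

theorem charMult_eq_coeff_add (hq : Function.Injective fun i : ℕ => q ^ i)
    (χ : MonoidAlgebra ℤ Fˣ) (w : Fˣ) :
    charMult q χ w = χ.coeff w + charMult q χ (q⁻¹ * w) := by
  have hs := finite_support_coeff_div hq χ w
  have hs' := finite_support_coeff_div hq χ (q⁻¹ * w)
  obtain ⟨N, hN⟩ := hs.bddAbove
  have h1 : charMult q χ w = ∑ i ∈ range (N + 1), χ.coeff (w / q ^ i) :=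
    finsum_eq_sum_of_support_subset _ fun i hi => by
      simpa [Nat.lt_succ_iff] using hN hi
  have h2 : charMult q χ (q⁻¹ * w) = ∑ i ∈ range N, χ.coeff (q⁻¹ * w / q ^ i) :=
    finsum_eq_sum_of_support_subset _ fun i hi => by
      have : i + 1 ≤ N := hN (by
        rw [Function.mem_support] at hi ⊢
        convert hi using 2
        rw [pow_succ, div_mul_eq_div_div, div_eq_inv_mul _ q, mul_div_assoc])
      simpa using this
  rw [h1, h2, sum_range_succ', add_comm]
  simp only [pow_zero, div_one]
  congr 1
  refine sum_congr rfl fun i _ => ?_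
  rw [pow_succ, div_mul_eq_div_div, div_eq_inv_mul _ q, mul_div_assoc]

theorem charMult_chr_sub_one_mul (hq : Function.Injective fun i : ℕ => q ^ i)
    (χ : MonoidAlgebra ℤ Fˣ) (w : Fˣ) :
    charMult q ((chr q - 1) * χ) w = -χ.coeff w := by
  rw [sub_mul, one_mul, sub_eq_add_neg, charMult_add hq, charMult_neg, charMult_chr_mul,
    charMult_eq_coeff_add hq χ w]
  ring

/-- The virtual characters `χ` for which `Φ(χ)` is a finite product. -/
def finiteChars (hq : Function.Injective fun i : ℕ => q ^ i) :
    AddSubgroup (MonoidAlgebra ℤ Fˣ) where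
  carrier := {χ | (Function.support (charMult q χ)).Finite}
  zero_mem' := by
    have : charMult q 0 = 0 := funext charMult_zero
    simp [this]
  add_mem' := by
    intro χ ψ hχ hψ
    refine (hχ.union hψ).subset fun w hw => ?_
    rw [Function.mem_support, charMult_add hq] at hw
    by_contra h
    rw [Set.mem_union, not_or, Function.notMem_support, Function.notMem_support] at h
    exact hw (by rw [h.1, h.2, add_zero])
  neg_mem' := by
    intro χ hχ
    refine hχ.subset fun w hw => ?_
    rw [Function.mem_support, charMult_neg] at hw
    exact fun h => hw (by rw [h, neg_zero])



theorem mem_finiteChars {hq : Function.Injective fun i : ℕ => q ^ i} {χ : MonoidAlgebra ℤ Fˣ} :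
    χ ∈ finiteChars hq ↔ (Function.support (charMult q χ)).Finite := Iff.rfl

theorem chr_mul_chr (v w : Fˣ) : chr v * chr w = chr (v * w) := by
  simp [chr, MonoidAlgebra.single_mul_single]

theorem chr_mul_mem_finiteChars {hq : Function.Injective fun i : ℕ => q ^ i} (v : Fˣ)
    {χ : MonoidAlgebra ℤ Fˣ} (hχ : χ ∈ finiteChars hq) : chr v * χ ∈ finiteChars hq := by
  rw [mem_finiteChars] at hχ ⊢
  refine Set.Finite.of_finite_image (f := fun w => v⁻¹ * w) (hχ.subset ?_)
    (mul_right_injective v⁻¹).injOn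
  rintro _ ⟨w, hw, rfl⟩
  rwa [Function.mem_support, charMult_chr_mul] at hw

theorem chr_sub_one_mul_mem_finiteChars (hq : Function.Injective fun i : ℕ => q ^ i)
    (χ : MonoidAlgebra ℤ Fˣ) : (chr q - 1) * χ ∈ finiteChars hq := by
  refine χ.coeff.support.finite_toSet.subset fun w hw => ?_
  rw [Function.mem_support, charMult_chr_sub_one_mul hq] at hw
  simpa using hw

theorem chr_pow_mul_sub_chr (w : Fˣ) (d : ℕ) :
    chr (q ^ d * w) - chr w = (chr q - 1) * ∑ i ∈ range d, chr (q ^ i * w) := by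
  induction d with
  | zero => simp
  | succ d ih =>
    rw [sum_range_succ, mul_add, ← ih, sub_mul, chr_mul_chr, one_mul, pow_succ', mul_assoc]
    abel

theorem chr_pow_mul_sub_chr_mem (hq : Function.Injective fun i : ℕ => q ^ i) (w : Fˣ) (d : ℕ) :
    chr (q ^ d * w) - chr w ∈ finiteChars hq := by
  rw [chr_pow_mul_sub_chr]
  exact chr_sub_one_mul_mem_finiteChars hq _

/-- `Φ` is multiplicative, provided that no factor `1 - 1` is cancelled. -/
theorem Phi_add (hq : Function.Injective fun i : ℕ => q ^ i) {χ ψ : MonoidAlgebra ℤ Fˣ}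
    (hχ : χ ∈ finiteChars hq) (hψ : ψ ∈ finiteChars hq) (h : charMult q ψ 1 = 0) :
    Phi q (χ + ψ) = Phi q χ * Phi q ψ := by
  have hfin : ∀ θ ∈ finiteChars hq,
      Function.HasFiniteMulSupport fun w : Fˣ => (1 - (w : F)) ^ charMult q θ w := by
    intro θ hθ
    refine Set.Finite.subset hθ fun w hw => ?_
    rw [Function.mem_mulSupport] at hw
    exact fun h0 => hw (by rw [h0, zpow_zero])
  rw [Phi_eq_finprod, Phi_eq_finprod, Phi_eq_finprod,
    ← finprod_mul_distrib (hfin χ hχ) (hfin ψ hψ)]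
  refine finprod_congr fun w => ?_
  rw [charMult_add hq]
  by_cases hw : w = 1
  · rw [hw, h, add_zero, zpow_zero, mul_one]
  · exact zpow_add₀ (sub_ne_zero.mpr fun h1 => hw (Units.ext h1.symm)) _ _

theorem Phi_add_sum (hq : Function.Injective fun i : ℕ => q ^ i) {χ : MonoidAlgebra ℤ Fˣ}
    (hχ : χ ∈ finiteChars hq) {ι : Type} (s : Finset ι) (ψ : ι → MonoidAlgebra ℤ Fˣ)
    (hψ : ∀ i ∈ s, ψ i ∈ finiteChars hq) (h : ∀ i ∈ s, charMult q (ψ i) 1 = 0) :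
    Phi q (χ + ∑ i ∈ s, ψ i) = Phi q χ * ∏ i ∈ s, Phi q (ψ i) := by
  classical
  induction s using Finset.induction_on with
  | empty => simp
  | insert i s hi ih =>
    rw [sum_insert hi, prod_insert hi, add_comm (ψ i), ← add_assoc,
      Phi_add hq (add_mem hχ (sum_mem fun j hj => hψ j (mem_insert_of_mem hj)))
        (hψ i (mem_insert_self i s)) (h i (mem_insert_self i s)),
      ih (fun j hj => hψ j (mem_insert_of_mem hj)) (fun j hj => h j (mem_insert_of_mem hj))]
    ring

theorem Phi_chr_sub_one_mul (hq : Function.Injective fun i : ℕ => q ^ i)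
    (χ : MonoidAlgebra ℤ Fˣ) :
    Phi q ((chr q - 1) * χ) = ∏ᶠ w : Fˣ, (1 - (w : F)) ^ (-χ.coeff w) := by
  simp only [Phi_eq_finprod, charMult_chr_sub_one_mul hq]

theorem Phi_chr_sub_one_mul_chr (hq : Function.Injective fun i : ℕ => q ^ i) (v : Fˣ) :
    Phi q ((chr q - 1) * chr v) = (1 - (v : F))⁻¹ := by
  rw [Phi_chr_sub_one_mul hq, finprod_eq_single _ v]
  · simp [chr]
  · intro w hw
    simp [chr, hw.symm]

theorem Phi_sub_chr_mul_chr (hq : Function.Injective fun i : ℕ => q ^ i) (v : Fˣ) :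
    Phi q ((1 - chr q) * chr v) = 1 - (v : F) := by
  have : (1 - chr q) * chr v = (chr q - 1) * (-chr v) := by ring
  rw [this, Phi_chr_sub_one_mul hq, finprod_eq_single _ v]
  · simp [chr]
  · intro w hw
    simp [chr, hw.symm]

theorem charMult_sub_mul_one (hq : Function.Injective fun i : ℕ => q ^ i) (ħ w : Fˣ) (d : ℕ)
    (h₁ : ∀ i < d, q ^ i * (q * w) ≠ 1) (h₂ : ∀ i < d, q ^ i * (ħ * w) ≠ 1) :
    charMult q ((chr q - chr ħ) * (chr (q ^ d * w) - chr w)) 1 = 0 := by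
  have : (chr q - chr ħ) * (chr (q ^ d * w) - chr w) = (chr q - 1) *
      (∑ i ∈ range d, chr (q ^ i * (q * w)) - ∑ i ∈ range d, chr (q ^ i * (ħ * w))) := by
    rw [mul_sub (chr q - 1), ← chr_pow_mul_sub_chr, ← chr_pow_mul_sub_chr, sub_mul, mul_sub,
      mul_sub, chr_mul_chr, chr_mul_chr, chr_mul_chr, chr_mul_chr, mul_left_comm, mul_left_comm ħ]
  rw [this, charMult_chr_sub_one_mul hq]
  simp only [MonoidAlgebra.coeff_sub, MonoidAlgebra.coeff_sum, Finsupp.sub_apply,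
    Finsupp.finsetSum_apply, chr, MonoidAlgebra.coeff_single]
  rw [sum_eq_zero, sum_eq_zero, sub_zero, neg_zero]
  · intro i hi
    exact Finsupp.single_eq_of_ne' (h₂ i (mem_range.mp hi))
  · intro i hi
    exact Finsupp.single_eq_of_ne' (h₁ i (mem_range.mp hi))

/-- `Φ((q - ħ)(q^d - 1)w) = (ħw)_d / (qw)_d`. -/
theorem Phi_sub_mul_chr_pow_sub (hq : Function.Injective fun i : ℕ => q ^ i) (ħ w : Fˣ) (d : ℕ)
    (h₁ : ∀ i < d, q ^ i * (q * w) ≠ 1) (h₂ : ∀ i < d, q ^ i * (ħ * w) ≠ 1) :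
    Phi q ((chr q - chr ħ) * (chr (q ^ d * w) - chr w)) =
      qPoch (q : F) (ħ * w) d / qPoch (q : F) (q * w) d := by
  have : (chr q - chr ħ) * (chr (q ^ d * w) - chr w) =
      0 + ∑ i ∈ range d, (chr q - 1) * chr (q ^ i * (q * w)) +
        ∑ i ∈ range d, (1 - chr q) * chr (q ^ i * (ħ * w)) := by
    rw [← mul_sum, ← mul_sum, ← neg_sub (chr q), neg_mul,
      ← chr_pow_mul_sub_chr, ← chr_pow_mul_sub_chr, sub_mul, mul_sub, mul_sub,
      chr_mul_chr, chr_mul_chr, chr_mul_chr, chr_mul_chr, mul_left_comm, mul_left_comm ħ]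
    abel
  have hneg : ∀ v : Fˣ, (1 - chr q) * chr v = (chr q - 1) * (-chr v) := fun v => by ring
  rw [this, Phi_add_sum hq, Phi_add_sum hq (zero_mem _)]
  · have h0 : Phi q (0 : MonoidAlgebra ℤ Fˣ) = 1 := by
      simp [Phi_eq_finprod, charMult_zero]
    simp only [h0, one_mul, Phi_chr_sub_one_mul_chr hq, Phi_sub_chr_mul_chr hq, prod_inv_distrib]
    rw [div_eq_inv_mul, qPoch, qPoch]
    congr 1
    · refine congrArg _ (prod_congr rfl fun i _ => ?_)
      push_cast
      ring
    · refine prod_congr rfl fun i _ => ?_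
      push_cast
      ring
  · exact fun i _ => chr_sub_one_mul_mem_finiteChars hq _
  · intro i hi
    rw [charMult_chr_sub_one_mul hq, chr, MonoidAlgebra.coeff_single,
      Finsupp.single_eq_of_ne' (h₁ i (mem_range.mp hi)), neg_zero]
  · rw [zero_add]
    exact sum_mem fun i _ => chr_sub_one_mul_mem_finiteChars hq _
  · intro i _
    rw [hneg]
    exact chr_sub_one_mul_mem_finiteChars hq _
  · intro i hi
    rw [hneg, charMult_chr_sub_one_mul hq, chr, MonoidAlgebra.coeff_neg, Finsupp.neg_apply,
      MonoidAlgebra.coeff_single, Finsupp.single_eq_of_ne' (h₂ i (mem_range.mp hi)), neg_zero,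
      neg_zero]

/-- `Φ` commutes with extensions of the field. -/
theorem Phi_mapDomain {F' : Type} [Field F'] (f : F →+* F') (q : Fˣ) (χ : MonoidAlgebra ℤ Fˣ) :
    Phi (Units.map (f : F →* F') q)
      (MonoidAlgebra.mapDomainRingHom ℤ (Units.map (f : F →* F')) χ) = f (Phi q χ) := by
  set g := Units.map (f : F →* F') with hg
  have hginj : Function.Injective g := Units.map_injective f.injective
  have hcoeff : ∀ w, (MonoidAlgebra.mapDomainRingHom ℤ g χ).coeff (g w) = χ.coeff w := fun w =>
    Finsupp.mapDomain_apply hginj _ _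
  have hcoeff' : ∀ w ∉ Set.range g, (MonoidAlgebra.mapDomainRingHom ℤ g χ).coeff w = 0 :=
    fun w hw => Finsupp.mapDomain_of_notMem_range _ _ hw
  have hmult : ∀ w, charMult (g q) (MonoidAlgebra.mapDomainRingHom ℤ g χ) (g w) =
      charMult q χ w := by
    intro w
    refine finsum_congr fun i => ?_
    rw [← map_pow, ← map_div, hcoeff]
  have hmult' : ∀ w ∉ Set.range g,
      charMult (g q) (MonoidAlgebra.mapDomainRingHom ℤ g χ) w = 0 := by
    intro w hw
    refine finsum_eq_zero_of_forall_eq_zero fun i => hcoeff' _ ?_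
    rintro ⟨v, hv⟩
    exact hw ⟨v * q ^ i, by rw [map_mul, hv, map_pow, div_mul_cancel]⟩
  rw [Phi_eq_finprod, Phi_eq_finprod]
  refine Eq.trans ?_ ((f : F →* F').map_finprod_of_injective f.injective
    fun w : Fˣ => (1 - (w : F)) ^ charMult q χ w).symm
  have hval : ∀ w : Fˣ, (f : F →* F') ((1 - (w : F)) ^ charMult q χ w) =
      (1 - (g w : F')) ^ charMult (g q) (MonoidAlgebra.mapDomainRingHom ℤ g χ) (g w) := by
    intro w
    rw [hmult]
    simp [hg, map_zpow₀]
  rw [finprod_congr hval, ← finprod_mem_range hginj (f := fun w' : F'ˣ => (1 - (w' : F')) ^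
    charMult (g q) (MonoidAlgebra.mapDomainRingHom ℤ g χ) w'), ← finprod_mem_univ]
  refine finprod_mem_inter_mulSupport_eq' _ _ _ fun w hw => ⟨fun _ => ?_, fun _ => trivial⟩
  by_contra h
  exact hw (by simp only [hmult' w h, zpow_zero])

end Phi

/-! ### The shifted polarization -/

section Polarization

variable {I E : Type} [Fintype E] {src tgt : E → I} {F : Type} [Field F] {ħ : Fˣ}
  {R S : Type} [Fintype R] [Fintype S] {q : Fˣ}

theorem chr_div_sub_chr_mem_finiteChars (hq : Function.Injective fun i : ℕ => q ^ i) (v : Fˣ)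
    (a b : ℕ) : chr (q ^ a / q ^ b * v) - chr v ∈ finiteChars hq := by
  have h := sub_mem (chr_pow_mul_sub_chr_mem hq (v / q ^ b) a)
    (chr_pow_mul_sub_chr_mem hq (v / q ^ b) b)
  have h1 : q ^ a * (v / q ^ b) = q ^ a / q ^ b * v := by
    rw [mul_div_assoc', div_mul_eq_mul_div]
  rwa [mul_div_cancel, sub_sub_sub_cancel_right, h1] at h

theorem ite_sub_ite_mem {G : Type} [AddGroup G] (H : AddSubgroup G) (P : Prop) [Decidable P]
    {a b : G} (h : a - b ∈ H) : (if P then a else 0) - (if P then b else 0) ∈ H := by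
  split_ifs
  · exact h
  · simp

theorem FixedPoint.polarization_shift_sub_mem (p : FixedPoint src tgt F ħ R S)
    (hq : Function.Injective fun i : ℕ => q ^ i) (d : R → ℕ) :
    p.polarization (p.shift q d) - p.polarization p.x ∈ finiteChars hq := by
  have hpair : ∀ r r', chr (p.shift q d r' / p.shift q d r) - chr (p.x r' / p.x r) ∈
      finiteChars hq := by
    intro r r'
    have := chr_div_sub_chr_mem_finiteChars hq (p.x r' / p.x r) (d r') (d r)
    rwa [div_mul_div_comm] at this
  have hfr : ∀ r s, chr (p.shift q d r / p.a s) - chr (p.x r / p.a s) ∈ finiteChars hq := by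
    intro r s
    have := chr_pow_mul_sub_chr_mem hq (p.x r / p.a s) (d r)
    rwa [← mul_div_assoc] at this
  classical
  rw [polarization, polarization, sub_sub_sub_comm, add_sub_add_comm]
  simp only [← sum_sub_distrib]
  exact sub_mem (add_mem
    (sum_mem fun _ _ => sum_mem fun r _ => sum_mem fun r' _ => ite_sub_ite_mem _ _ (hpair r r'))
    (sum_mem fun s _ => sum_mem fun r _ => ite_sub_ite_mem _ _ (hfr r s)))
    (sum_mem fun r _ => sum_mem fun r' _ => ite_sub_ite_mem _ _ (hpair r r'))

end Polarization

/-! ### Adding a framing -/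

section Framing

variable {I E : Type} [Fintype E] {src tgt : E → I} {F F' : Type} [Field F] [Field F'] {ħ : Fˣ}
  {ħ' : F'ˣ} {R : Type} [Fintype R] {p : FixedPoint src tgt F ħ R Unit}
  {p' : FixedPoint src tgt F' ħ' R (Fin 2)} {c : F'ˣ}

theorem mapDomainRingHom_chr (g : Fˣ →* F'ˣ) (w : Fˣ) :
    MonoidAlgebra.mapDomainRingHom ℤ g (chr w) = chr (g w) := by
  simp [chr]

theorem FixedPoint.polarization_add_framing [DecidableEq I] (g : Fˣ →* F'ˣ)
    (hv : p'.vtx = p.vtx) (hf : p'.fr 0 = p.fr ()) (ha : p.a () = 1) (ha₀ : p'.a 0 = c)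
    (ha₁ : p'.a 1 = 1) (y : R → Fˣ) :
    p'.polarization (fun r => c * g (y r)) =
      MonoidAlgebra.mapDomainRingHom ℤ g (p.polarization y) +
        ∑ r with p.vtx r = p'.fr 1, chr (c * g (y r)) := by
  classical
  have h1 : ∀ r r', c * g (y r') / (c * g (y r)) = g (y r' / y r) := by
    intro r r'
    rw [mul_div_mul_left_eq_div, map_div]
  have h2 : ∀ r, c * g (y r) / c = g (y r) := fun r => mul_div_cancel_left _ _
  have h3 : ∀ (P : Prop) [Decidable P] (w : Fˣ), MonoidAlgebra.mapDomainRingHom ℤ g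
      (if P then chr w else 0) = if P then chr (g w) else 0 := by
    intro P _ w
    rw [apply_ite (MonoidAlgebra.mapDomainRingHom ℤ g), map_zero, mapDomainRingHom_chr]
  rw [polarization, polarization, hv, map_sub, map_add, add_sub_right_comm, add_sub_right_comm,
    add_assoc]
  refine congrArg₂ (· + ·) ?_ ?_
  · simp only [map_sum, h1, h3]
    congr!
  · rw [Fin.sum_univ_two, sum_filter]
    simp only [map_sum, h3, hf, ha, ha₀, ha₁, h2, div_one, univ_unique, sum_singleton]

theorem FixedPoint.Phi_add_framing [DecidableEq I] (f : F →+* F') {g : Fˣ →* F'ˣ}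
    (hg : g = Units.map (f : F →* F')) {q : Fˣ} (hq : Function.Injective fun i : ℕ => g q ^ i)
    (hc : ∀ w, c * g w ≠ 1) (hv : p'.vtx = p.vtx) (hf : p'.fr 0 = p.fr ()) (ha : p.a () = 1)
    (ha₀ : p'.a 0 = c) (ha₁ : p'.a 1 = 1) (hx : ∀ r, p'.x r = c * g (p.x r)) (d : R → ℕ) :
    Phi (g q) ((chr (g q) - chr (g ħ)) *
      (p'.polarization (p'.shift (g q) d) - p'.polarization p'.x)) =
    f (Phi q ((chr q - chr ħ) * (p.polarization (p.shift q d) - p.polarization p.x))) *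
      ∏ r with p.vtx r = p'.fr 1,
        (qPoch (f q) (f ħ * (c * f (p.x r))) (d r) / qPoch (f q) (f q * (c * f (p.x r))) (d r)) := by
  have hmem : ∀ χ ∈ finiteChars hq, (chr (g q) - chr (g ħ)) * χ ∈ finiteChars hq := by
    intro χ hχ
    rw [sub_mul]
    exact sub_mem (chr_mul_mem_finiteChars _ hχ) (chr_mul_mem_finiteChars _ hχ)
  have hne : ∀ v w : Fˣ, ∀ i : ℕ, g q ^ i * (g v * (c * g w)) ≠ 1 := by
    intro v w i h
    refine hc (q ^ i * (v * w)) (Eq.trans ?_ h)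
    simp only [map_mul, map_pow]
    rw [mul_left_comm c, mul_left_comm c]
  have hshift : p'.shift (g q) d = fun r => c * g (p.shift q d r) := by
    funext r
    rw [shift, shift, hx, map_mul, map_pow, mul_left_comm]
  have hsplit : (chr (g q) - chr (g ħ)) *
      (p'.polarization (p'.shift (g q) d) - p'.polarization p'.x) =
      MonoidAlgebra.mapDomainRingHom ℤ g ((chr q - chr ħ) *
        (p.polarization (p.shift q d) - p.polarization p.x)) +
      ∑ r with p.vtx r = p'.fr 1,
        (chr (g q) - chr (g ħ)) * (chr (g q ^ d r * (c * g (p.x r))) - chr (c * g (p.x r))) := by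
    rw [hshift, funext hx, polarization_add_framing g hv hf ha ha₀ ha₁,
      polarization_add_framing g hv hf ha ha₀ ha₁, add_sub_add_comm, ← sum_sub_distrib,
      ← mul_sum, map_mul, map_sub, map_sub, mapDomainRingHom_chr, mapDomainRingHom_chr, mul_add]
    refine congrArg _ (congrArg _ (sum_congr rfl fun r _ => ?_))
    rw [shift, map_mul, map_pow, mul_left_comm]
  have hextra : ∀ r, (chr (g q) - chr (g ħ)) * (chr (g q ^ d r *
      (c * g (p.x r))) - chr (c * g (p.x r))) ∈ finiteChars hq :=
    fun r => hmem _ (chr_pow_mul_sub_chr_mem hq _ _)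
  have htotal := hmem _ (p'.polarization_shift_sub_mem hq d)
  have hmain : MonoidAlgebra.mapDomainRingHom ℤ g ((chr q - chr ħ) *
        (p.polarization (p.shift q d) - p.polarization p.x)) ∈ finiteChars hq := by
    rw [hsplit] at htotal
    exact ((finiteChars hq).add_mem_cancel_right (sum_mem fun r _ => hextra r)).mp htotal
  rw [hsplit, Phi_add_sum hq hmain]
  · subst hg
    rw [Phi_mapDomain f]
    refine congrArg _ (prod_congr rfl fun r _ => ?_)
    rw [Phi_sub_mul_chr_pow_sub hq _ _ _ (fun i _ => hne _ _ i) (fun i _ => hne _ _ i)]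
    simp only [Units.val_mul, Units.coe_map, MonoidHom.coe_coe]
  · exact fun r _ => hextra r
  · exact fun r _ => charMult_sub_mul_one hq _ _ _ (fun i _ => hne _ _ i) (fun i _ => hne _ _ i)

end Framing

/-! ### The coefficient fields -/

theorem qq_pow_mul_hh_pow_inj {a b c d : ℕ}
    (h : (qq : Cqh) ^ a * (hh : Cqh) ^ b = (qq : Cqh) ^ c * (hh : Cqh) ^ d) : a = c ∧ b = d := by
  simp only [qq, hh, Units.val_mk0, ← map_pow, ← map_mul] at h
  have h' := IsFractionRing.injective (MvPolynomial (Fin 2) ℂ) Cqh h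
  simp only [MvPolynomial.X_pow_eq_monomial, MvPolynomial.monomial_mul, mul_one] at h'
  have h2 := MvPolynomial.monomial_left_injective (one_ne_zero (α := ℂ)) h'
  have h0 := DFunLike.congr_fun h2 0
  have h1 := DFunLike.congr_fun h2 1
  simp at h0 h1
  exact ⟨h0, h1⟩

instance : CharZero Cqh :=
  charZero_of_injective_algebraMap (IsFractionRing.injective (MvPolynomial (Fin 2) ℂ) Cqh)

theorem qq_pow_ne_one {j : ℕ} (hj : 0 < j) : (qq : Cqh) ^ j ≠ 1 := by
  intro h
  have := qq_pow_mul_hh_pow_inj (a := j) (b := 0) (c := 0) (d := 0) (by simpa using h)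
  omega

theorem qq_div_hh_pow_ne_one {j : ℕ} (hj : 0 < j) : ((qq : Cqh) / hh) ^ j ≠ 1 := by
  intro h
  rw [div_pow, div_eq_one_iff_eq (pow_ne_zero _ hh.ne_zero)] at h
  have := qq_pow_mul_hh_pow_inj (a := j) (b := 0) (c := 0) (d := j) (by simpa using h)
  omega

theorem qq_div_hh_mul_qq_pow_ne_one (i : ℕ) : (qq : Cqh) / hh * (qq : Cqh) ^ i ≠ 1 := by
  intro h
  rw [div_mul_eq_mul_div, div_eq_one_iff_eq hh.ne_zero, ← pow_succ'] at h
  have := qq_pow_mul_hh_pow_inj (a := i + 1) (b := 0) (c := 0) (d := 1) (by simpa using h)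
  omega

theorem liftU_qq_pow_injective : Function.Injective fun i : ℕ => liftU qq ^ i := by
  intro i j hij
  have h : liftU (qq ^ i) = liftU (qq ^ j) := by simpa only [map_pow] using hij
  have h' := Units.map_injective (f := (algebraMap Cqh Cqhu : Cqh →* Cqhu))
    (algebraMap Cqh Cqhu).injective h
  have := qq_pow_mul_hh_pow_inj (a := i) (b := 0) (c := j) (d := 0)
    (by simpa using congrArg Units.val h')
  exact this.1

theorem uu_mul_liftU_ne_one (c : Cqhˣ) : uu * liftU c ≠ 1 := by
  intro h
  have h1 : (RatFunc.X : Cqhu) * algebraMap Cqh Cqhu c = 1 := by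
    simpa [uu] using congrArg Units.val h
  rw [IsScalarTower.algebraMap_apply Cqh (Polynomial Cqh) Cqhu, ← RatFunc.algebraMap_X,
    ← map_mul, ← map_one (algebraMap (Polynomial Cqh) Cqhu)] at h1
  have h2 := congrArg (Polynomial.coeff · 0) (RatFunc.algebraMap_injective Cqh h1)
  simp at h2

/-! ### Comparison of the two vertex functions, term by term -/

theorem dualPoint_Phi {k n : ℕ} (hk : 1 ≤ k) (hkn : 2 * k ≤ n) (d : Box k n → ℕ) :
    Phi (liftU qq) ((chr (liftU qq) - chr (liftU hh)) *
      ((dualPoint k n hk hkn).polarization ((dualPoint k n hk hkn).shift (liftU qq) d) -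
        (dualPoint k n hk hkn).polarization (dualPoint k n hk hkn).x)) =
    algebraMap Cqh Cqhu (Phi qq ((chr qq - chr hh) *
      ((lambdaPoint k n hk hkn).polarization ((lambdaPoint k n hk hkn).shift qq d) -
        (lambdaPoint k n hk hkn).polarization (lambdaPoint k n hk hkn).x))) *
      ∏ r : Box k n with content r = vertexNK k n hk hkn,
        (qPoch (algebraMap Cqh Cqhu qq) (algebraMap Cqh Cqhu hh *
            (uu * algebraMap Cqh Cqhu ((lambdaPoint k n hk hkn).x r))) (d r) /
          qPoch (algebraMap Cqh Cqhu qq) (algebraMap Cqh Cqhu qq *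
            (uu * algebraMap Cqh Cqhu ((lambdaPoint k n hk hkn).x r))) (d r)) := by
  refine FixedPoint.Phi_add_framing (p := lambdaPoint k n hk hkn) (p' := dualPoint k n hk hkn)
    (algebraMap Cqh Cqhu) rfl liftU_qq_pow_injective uu_mul_liftU_ne_one rfl rfl rfl rfl rfl
    (fun r => ?_) d
  change uu * liftU hh ^ (r.2 : ℕ) = uu * liftU (1 * hh ^ (r.2 : ℕ))
  rw [one_mul, map_pow]

/-! ### `q`-difference and differential equations of `φ` -/

section QSeries

variable {K : Type} [Field K] {q : K}

open PowerSeries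

theorem qPoch_succ (q x : K) (n : ℕ) : qPoch q x (n + 1) = qPoch q x n * (1 - x * q ^ n) :=
  prod_range_succ _ _

theorem qPoch_self_ne_zero (hq : ∀ j > 0, q ^ j ≠ 1) (n : ℕ) : qPoch q q n ≠ 0 := by
  rw [qPoch, prod_ne_zero_iff]
  intro i _ h
  exact hq (i + 1) i.succ_pos (by rw [pow_succ']; exact (sub_eq_zero.mp h).symm)

theorem coeff_qPhi_succ (hq : ∀ j > 0, q ^ j ≠ 1) (n : ℕ) :
    (1 - q ^ (n + 1)) * coeff (n + 1) (qPhi q) = -q ^ n * coeff n (qPhi q) := by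
  have h0 := qPoch_self_ne_zero hq n
  have h1 : 1 - q ^ (n + 1) ≠ 0 := sub_ne_zero.mpr (hq _ n.succ_pos).symm
  rw [qPhi, coeff_mk, coeff_mk, qPoch_succ, Nat.choose_succ_succ' n 1, Nat.choose_one_right,
    ← pow_succ']
  field_simp
  ring

theorem constantCoeff_qPhi : coeff 0 (qPhi q) = 1 := by
  simp [qPhi, qPoch]

@[simp]
theorem constantCoeff_rescale_apply (a : K) (f : PowerSeries K) :
    constantCoeff (rescale a f) = constantCoeff f := by
  rw [← coeff_zero_eq_constantCoeff_apply, coeff_rescale, pow_zero, one_mul,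
    coeff_zero_eq_constantCoeff_apply]

theorem coeff_one_sub_C_mul_X_mul (c : K) (f : PowerSeries K) (n : ℕ) :
    coeff (n + 1) ((1 - C c * X) * f) = coeff (n + 1) f - c * coeff n f := by
  rw [sub_mul, one_mul, map_sub, mul_assoc, coeff_C_mul, coeff_succ_X_mul]

/-- A solution of `f(x) = (1 - c x) f(q x)` is determined by its constant term. -/
theorem eq_of_qDifference (hq : ∀ j > 0, q ^ j ≠ 1) {c : K} {f g : PowerSeries K}
    (hf : f = (1 - C c * X) * rescale q f) (hg : g = (1 - C c * X) * rescale q g)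
    (h0 : coeff 0 f = coeff 0 g) : f = g := by
  have hrec : ∀ f : PowerSeries K, f = (1 - C c * X) * rescale q f → ∀ n,
      (1 - q ^ (n + 1)) * coeff (n + 1) f = -c * q ^ n * coeff n f := by
    intro f hf n
    have h := congrArg (coeff (n + 1)) hf
    rw [coeff_one_sub_C_mul_X_mul, coeff_rescale, coeff_rescale] at h
    linear_combination h
  ext n
  induction n with
  | zero => exact h0
  | succ n ih =>
    refine mul_left_cancel₀ (sub_ne_zero.mpr (hq _ n.succ_pos).symm) ?_
    rw [hrec f hf, hrec g hg, ih]

theorem qPhi_eq (hq : ∀ j > 0, q ^ j ≠ 1) : qPhi q = (1 - X) * rescale q (qPhi q) := by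
  have h1 : (1 - X : PowerSeries K) = 1 - C 1 * X := by simp
  ext n
  rw [h1]
  cases n with
  | zero => simp
  | succ n =>
    rw [coeff_one_sub_C_mul_X_mul, coeff_rescale, coeff_rescale]
    linear_combination coeff_qPhi_succ hq n

theorem rescale_qPhi_eq (hq : ∀ j > 0, q ^ j ≠ 1) (c : K) :
    rescale c (qPhi q) = (1 - C c * X) * rescale (c * q) (qPhi q) := by
  conv_lhs => rw [qPhi_eq hq]
  rw [map_mul, map_sub, map_one, rescale_X, rescale_rescale, mul_comm q]

/-- `φ(c x) = (c x)_d φ(c q^d x)`. -/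
theorem rescale_qPhi_eq_prod_mul (hq : ∀ j > 0, q ^ j ≠ 1) (c : K) (d : ℕ) :
    rescale c (qPhi q) = (∏ i ∈ range d, (1 - C (c * q ^ i) * X)) *
      rescale (c * q ^ d) (qPhi q) := by
  induction d with
  | zero => simp
  | succ d ih =>
    rw [prod_range_succ, mul_assoc, pow_succ, ← mul_assoc c, ← rescale_qPhi_eq hq, ← ih]

/-- The `q`-binomial theorem. -/
theorem qBinomial (hq : ∀ j > 0, q ^ j ≠ 1) (t : K) :
    PowerSeries.mk (fun d => qPoch q t d / qPoch q q d) * qPhi q = rescale t (qPhi q) := by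
  refine eq_of_qDifference hq (c := t) ?_ ?_ ?_
  · have hb : PowerSeries.mk (fun d => qPoch q t d / qPoch q q d) * (1 - X) =
        (1 - C t * X) * rescale q (PowerSeries.mk fun d => qPoch q t d / qPoch q q d) := by
      have h1 : (1 - X : PowerSeries K) = 1 - C 1 * X := by simp
      rw [h1, mul_comm]
      ext n
      cases n with
      | zero => simp [qPoch]
      | succ n =>
        rw [coeff_one_sub_C_mul_X_mul, coeff_one_sub_C_mul_X_mul, coeff_rescale, coeff_rescale,
          coeff_mk, coeff_mk, qPoch_succ, qPoch_succ, ← pow_succ']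
        have h0 := qPoch_self_ne_zero hq n
        have h1 : 1 - q ^ (n + 1) ≠ 0 := sub_ne_zero.mpr (hq _ n.succ_pos).symm
        field_simp
        ring
    conv_lhs => rw [qPhi_eq hq]
    rw [← mul_assoc, hb, map_mul, mul_assoc]
  · conv_lhs => rw [rescale_qPhi_eq hq]
    rw [rescale_rescale]
  · simp [qPhi, qPoch]

/-- The Euler operator `x d/dx`. -/
def euler (f : PowerSeries K) : PowerSeries K := X * d⁄dX K f

theorem coeff_euler (f : PowerSeries K) (n : ℕ) : coeff n (euler f) = n * coeff n f := by
  cases n with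
  | zero => simp [euler]
  | succ n => rw [euler, coeff_succ_X_mul, coeff_derivative, mul_comm, Nat.cast_succ]

theorem euler_mul (f g : PowerSeries K) : euler (f * g) = euler f * g + f * euler g := by
  simp only [euler, Derivation.leibniz, smul_eq_mul]
  ring

theorem euler_prod {ι : Type} (s : Finset ι) (f L : ι → PowerSeries K)
    (h : ∀ i ∈ s, euler (f i) = L i * f i) :
    euler (∏ i ∈ s, f i) = (∑ i ∈ s, L i) * ∏ i ∈ s, f i := by
  classical
  induction s using Finset.induction_on with
  | empty => simp [euler]
  | insert i s hi ih =>
    rw [prod_insert hi, sum_insert hi, euler_mul, h i (mem_insert_self i s),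
      ih fun j hj => h j (mem_insert_of_mem hj)]
    ring

theorem euler_rescale (c : K) (f : PowerSeries K) :
    euler (rescale c f) = rescale c (euler f) := by
  ext n
  simp only [coeff_euler, coeff_rescale]
  ring

/-- A solution of `x f'(x) = s(x) f(x)`, where `s(0) = 0`, is determined by its constant term. -/
theorem eq_of_euler_eq [CharZero K] {s f g : PowerSeries K} (hs : coeff 0 s = 0)
    (hf : euler f = s * f) (hg : euler g = s * g) (h0 : coeff 0 f = coeff 0 g) : f = g := by
  ext n
  induction n using Nat.strong_induction_on with
  | _ n ih =>
    rcases Nat.eq_zero_or_pos n with rfl | hn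
    · exact h0
    · refine mul_left_cancel₀ (Nat.cast_ne_zero.mpr hn.ne' : (n : K) ≠ 0) ?_
      rw [← coeff_euler, ← coeff_euler, hf, hg, coeff_mul, coeff_mul]
      refine sum_congr rfl fun p hp => ?_
      rcases Nat.eq_zero_or_pos p.1 with h | h
      · rw [h, hs, zero_mul, zero_mul]
      · rw [ih p.2 (by rw [HasAntidiagonal.mem_antidiagonal] at hp; omega)]

/-- The logarithmic derivative of `1 / φ(x)`, that is `∑_{n ≥ 1} x^n / (1 - q^n)`. -/
def qLambert (q : K) : PowerSeries K := PowerSeries.mk fun n => 1 / (1 - q ^ n)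

theorem qLambert_sub_rescale (hq : ∀ j > 0, q ^ j ≠ 1) :
    (qLambert q - rescale q (qLambert q)) * (1 - X) = X := by
  have h1 : (1 - X : PowerSeries K) = 1 - C 1 * X := by simp
  have h2 : ∀ n, coeff (n + 1) (qLambert q - rescale q (qLambert q)) = 1 := by
    intro n
    have h : 1 - q ^ (n + 1) ≠ 0 := sub_ne_zero.mpr (hq _ n.succ_pos).symm
    rw [map_sub, coeff_rescale, qLambert, coeff_mk]
    field_simp
  rw [h1, mul_comm]
  ext n
  cases n with
  | zero => simp [qLambert]
  | succ n =>
    rw [coeff_one_sub_C_mul_X_mul, h2, coeff_X]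
    cases n with
    | zero => simp [qLambert]
    | succ n => simp [h2]

theorem euler_qPhi (hq : ∀ j > 0, q ^ j ≠ 1) : euler (qPhi q) = -qLambert q * qPhi q := by
  have h : euler (qPhi q) + qLambert q * qPhi q = 0 := by
    refine eq_of_qDifference hq (c := 1) ?_ (by simp) (by simp [euler, qLambert])
    have h1 : (1 - C 1 * X : PowerSeries K) = 1 - X := by simp
    have h2 : euler (1 - X : PowerSeries K) = -X := by simp [euler]
    have h3 := qLambert_sub_rescale hq
    have h4 : euler (qPhi q) = -X * rescale q (qPhi q) + (1 - X) * rescale q (euler (qPhi q)) := by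
      conv_lhs => rw [qPhi_eq hq]
      rw [euler_mul, h2, euler_rescale]
    rw [h1, map_add, map_mul]
    linear_combination h4 + qLambert q * qPhi_eq hq + rescale q (qPhi q) * h3
  linear_combination h

theorem euler_rescale_qPhi (hq : ∀ j > 0, q ^ j ≠ 1) (c : K) :
    euler (rescale c (qPhi q)) = -rescale c (qLambert q) * rescale c (qPhi q) := by
  rw [euler_rescale, euler_qPhi hq, map_mul, map_neg]

end QSeries

/-! ### Sums over partitions -/

section Partitions

variable {K : Type} [Field K]

/-- `∏_j j^{m_j} m_j!` for a multiset with multiplicities `m_j`. -/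
def zCard (s : Multiset ℕ) : ℕ := ∏ j ∈ s.toFinset, j ^ s.count j * (s.count j).factorial

theorem zCard_eq_prod {s : Multiset ℕ} {T : Finset ℕ} (h : s.toFinset ⊆ T) :
    zCard s = ∏ j ∈ T, j ^ s.count j * (s.count j).factorial := by
  refine prod_subset h fun j _ hj => ?_
  rw [Multiset.count_eq_zero_of_notMem (by simpa using hj)]
  simp

theorem zCard_cons (j : ℕ) (s : Multiset ℕ) :
    zCard (j ::ₘ s) = j * (s.count j + 1) * zCard s := by
  have hs : s.toFinset ⊆ insert j s.toFinset := subset_insert _ _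
  have hj : j ∈ insert j s.toFinset := mem_insert_self _ _
  rw [zCard_eq_prod (T := insert j s.toFinset) (by simp), zCard_eq_prod hs,
    ← mul_prod_erase _ _ hj, ← mul_prod_erase _ _ hj, Multiset.count_cons_self, pow_succ,
    Nat.factorial_succ]
  have : ∏ i ∈ (insert j s.toFinset).erase j,
      i ^ (j ::ₘ s).count i * ((j ::ₘ s).count i).factorial =
      ∏ i ∈ (insert j s.toFinset).erase j, i ^ s.count i * (s.count i).factorial := by
    refine prod_congr rfl fun i hi => ?_
    rw [Multiset.count_cons_of_ne (ne_of_mem_erase hi)]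
  rw [this]
  ring

theorem zCard_pos {d : ℕ} (ν : Nat.Partition d) : 0 < zCard ν.parts :=
  prod_pos fun j hj =>
    Nat.mul_pos (pow_pos (ν.parts_pos (by simpa using hj)) _) (Nat.factorial_pos _)

/-- The term of the partition `ν` in `exp(∑_j c_j y^j / j)`. -/
def partWeight (c : ℕ → K) (s : Multiset ℕ) : K := (s.map c).prod / zCard s

theorem partWeight_cons [CharZero K] (c : ℕ → K) {j : ℕ} (hj : 0 < j) (s : Multiset ℕ) :
    j * (j ::ₘ s).count j * partWeight c (j ::ₘ s) = c j * partWeight c s := by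
  have h1 : (j : K) ≠ 0 := Nat.cast_ne_zero.mpr hj.ne'
  have h2 : (s.count j + 1 : K) ≠ 0 := Nat.cast_add_one_ne_zero _
  rw [partWeight, partWeight, zCard_cons, Multiset.map_cons, Multiset.prod_cons,
    Multiset.count_cons_self]
  push_cast
  rw [mul_div_assoc', mul_div_mul_left _ _ (mul_ne_zero h1 h2),
    mul_div_assoc]

/-- The partition `ν` with a part `j` added. -/
def consPartition {d e : ℕ} (j : ℕ) (hj : 0 < j) (h : j + d = e) (ν : Nat.Partition d) :
    Nat.Partition e where
  parts := j ::ₘ ν.parts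
  parts_pos := by
    intro i hi
    rcases Multiset.mem_cons.mp hi with rfl | hi
    · exact hj
    · exact ν.parts_pos hi
  parts_sum := by rw [Multiset.sum_cons, ν.parts_sum, h]

theorem sum_count_mul_partWeight [CharZero K] (c : ℕ → K) {j d e : ℕ} (hj : 0 < j)
    (h : j + d = e) :
    ∑ ν : Nat.Partition e, j * ν.parts.count j * partWeight c ν.parts =
      c j * ∑ ν : Nat.Partition d, partWeight c ν.parts := by
  rw [mul_sum]
  symm
  refine sum_of_injOn (consPartition j hj h) ?_ (fun _ _ => mem_coe.mpr (mem_univ _)) ?_ ?_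
  · intro ν _ μ _ hνμ
    have := congrArg Nat.Partition.parts hνμ
    exact Nat.Partition.ext ((Multiset.cons_inj_right j).mp this)
  · intro ν _ hν
    have : j ∉ ν.parts := by
      intro hmem
      refine hν ⟨⟨ν.parts.erase j, fun hi => ν.parts_pos (Multiset.mem_of_mem_erase hi), ?_⟩,
        mem_coe.mpr (mem_univ _), ?_⟩
      · have := ν.parts_sum
        rw [← Multiset.cons_erase hmem, Multiset.sum_cons] at this
        omega
      · exact Nat.Partition.ext (Multiset.cons_erase hmem)
    rw [Multiset.count_eq_zero_of_notMem this, Nat.cast_zero, mul_zero, zero_mul]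
  · intro ν _
    exact (partWeight_cons c hj ν.parts).symm

theorem sum_mul_count_parts {d : ℕ} (ν : Nat.Partition d) :
    ∑ p ∈ antidiagonal d, p.1 * ν.parts.count p.1 = d := by
  rw [Nat.sum_antidiagonal_eq_sum_range_succ_mk]
  conv_rhs => rw [← ν.parts_sum, sum_multiset_count]
  simp only [smul_eq_mul, mul_comm]
  symm
  refine sum_subset (fun i hi => ?_) fun i _ hi => ?_
  · rw [mem_range, Nat.lt_succ_iff]
    exact Nat.Partition.le_of_mem_parts (by simpa using hi)
  · rw [Multiset.count_eq_zero_of_notMem (by simpa using hi), mul_zero]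

/-- The series `exp(∑_j c_j y^j / j)`. -/
def partSeries (c : ℕ → K) : PowerSeries K :=
  PowerSeries.mk fun d => ∑ ν : Nat.Partition d, partWeight c ν.parts

theorem euler_partSeries [CharZero K] {c : ℕ → K} (hc : c 0 = 0) :
    euler (partSeries c) = PowerSeries.mk c * partSeries c := by
  ext d
  rw [coeff_euler, PowerSeries.coeff_mul]
  simp only [partSeries, PowerSeries.coeff_mk]
  have h : ∀ p ∈ antidiagonal d, c p.1 * ∑ ν : Nat.Partition p.2, partWeight c ν.parts =
      ∑ ν : Nat.Partition d, p.1 * ν.parts.count p.1 * partWeight c ν.parts := by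
    intro p hp
    rcases Nat.eq_zero_or_pos p.1 with h0 | h0
    · simp [h0, hc]
    · exact (sum_count_mul_partWeight c h0 (mem_antidiagonal.mp hp)).symm
  rw [sum_congr rfl h, sum_comm, mul_sum]
  refine sum_congr rfl fun ν _ => ?_
  rw [← sum_mul]
  congr 1
  conv_lhs => rw [← sum_mul_count_parts ν]
  push_cast
  rfl

/-- The generating function `∏_i φ(t x_i y) / φ(x_i y)` of the one-row Macdonald polynomials. -/
theorem partSeries_mul_prod_qPhi [CharZero K] {q : K} (hq : ∀ j > 0, q ^ j ≠ 1) (t : K)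
    {σ : Type} [Fintype σ] (x : σ → K) :
    partSeries (fun j => (1 - t ^ j) / (1 - q ^ j) * ∑ i, x i ^ j) *
        ∏ i, PowerSeries.rescale (x i) (qPhi q) =
      ∏ i, PowerSeries.rescale (t * x i) (qPhi q) := by
  have hM := euler_prod univ (fun i => PowerSeries.rescale (x i) (qPhi q)) _
    fun i _ => euler_rescale_qPhi hq (x i)
  have hN := euler_prod univ (fun i => PowerSeries.rescale (t * x i) (qPhi q)) _
    fun i _ => euler_rescale_qPhi hq (t * x i)
  refine eq_of_euler_eq ?_ ?_ hN ?_
  · simp [qLambert]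
  · rw [euler_mul, euler_partSeries (by simp), hM, mul_left_comm, ← mul_assoc, ← mul_assoc,
      ← add_mul, ← add_mul]
    congr 2
    ext j
    simp only [map_add, map_sum, map_neg, PowerSeries.coeff_mk, PowerSeries.coeff_rescale,
      qLambert, mul_sum, ← sum_add_distrib, mul_pow]
    refine sum_congr rfl fun i _ => ?_
    ring
  · simp only [PowerSeries.coeff_zero_eq_constantCoeff, map_mul, map_prod]
    simp only [← PowerSeries.coeff_zero_eq_constantCoeff_apply, PowerSeries.coeff_rescale,
      constantCoeff_qPhi, partSeries, PowerSeries.coeff_mk, univ_unique, sum_singleton]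
    simp [partWeight, zCard]

end Partitions

/-! ### Monomial expansions of symmetric polynomials -/

section Monomial

variable {K : Type} [Field K] {σ : Type} [Fintype σ] {d : ℕ}

theorem exists_perm_comp_eq {α β : Type} [Fintype α] [DecidableEq β] {f g : α → β}
    (h : univ.val.map f = univ.val.map g) : ∃ e : Equiv.Perm α, ∀ a, g (e a) = f a := by
  classical
  have hcard : ∀ v, Fintype.card {a // f a = v} = Fintype.card {a // g a = v} := by
    intro v
    have := congrArg (Multiset.count v) h
    rw [Multiset.count_map, Multiset.count_map] at this
    rw [Fintype.card_subtype, Fintype.card_subtype, card_def, card_def, filter_val, filter_val]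
    simpa only [eq_comm] using this
  refine ⟨(Equiv.sigmaFiberEquiv f).symm.trans ((Equiv.sigmaCongrRight fun v =>
    Fintype.equivOfCardEq (hcard v)).trans (Equiv.sigmaFiberEquiv g)), fun a => ?_⟩
  exact (Fintype.equivOfCardEq (hcard (f a)) ⟨a, rfl⟩).2

theorem map_count_univ [DecidableEq σ] (s : Sym σ d) :
    univ.val.map (fun a => s.1.count a) =
      (Nat.Partition.ofSym s).parts +
        Multiset.replicate (Fintype.card σ - (Nat.Partition.ofSym s).parts.card) 0 := by
  have hsplit : (univ : Finset σ).val = s.1.toFinset.val + (s.1.toFinsetᶜ).val := by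
    rw [← disjUnion_val _ _ disjoint_compl_right, disjUnion_eq_union, union_compl]
  have h0 : (s.1.toFinsetᶜ).val.map (fun a => s.1.count a) =
      Multiset.replicate (Fintype.card σ - (Nat.Partition.ofSym s).parts.card) 0 := by
    rw [Multiset.eq_replicate]
    constructor
    · rw [Multiset.card_map, ← card_def, card_compl]
      simp [Nat.Partition.ofSym, Multiset.toFinset, card_def]
    · intro m hm
      obtain ⟨a, ha, rfl⟩ := Multiset.mem_map.mp hm
      exact Multiset.count_eq_zero_of_notMem (by simpa using ha)
  rw [hsplit, Multiset.map_add, h0]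
  rfl

theorem exists_perm_map_eq_of_ofSym_eq [DecidableEq σ] {s s' : Sym σ d}
    (h : Nat.Partition.ofSym s = Nat.Partition.ofSym s') :
    ∃ e : Equiv.Perm σ, s'.1 = s.1.map e := by
  obtain ⟨e, he⟩ := exists_perm_comp_eq (f := fun a => s.1.count a) (g := fun a => s'.1.count a)
    (by rw [map_count_univ, map_count_univ, h])
  refine ⟨e, Multiset.ext.mpr fun a => ?_⟩
  obtain ⟨b, rfl⟩ := e.surjective a
  rw [Multiset.count_map_eq_count' _ _ e.injective]
  exact he b

theorem prod_map_X {ι : Type} [DecidableEq ι] (s : Multiset ι) :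
    (s.map (MvPolynomial.X (R := K))).prod = MvPolynomial.monomial (Multiset.toFinsupp s) 1 := by
  induction s using Multiset.induction_on with
  | empty => simp
  | cons a s ih =>
    rw [Multiset.map_cons, Multiset.prod_cons, ih, MvPolynomial.X, MvPolynomial.monomial_mul,
      ← Multiset.singleton_add, map_add, Multiset.toFinsupp_singleton, one_mul]

theorem sum_C_mul_msymm [DecidableEq σ] (c : Nat.Partition d → K) :
    ∑ μ, MvPolynomial.C (c μ) * MvPolynomial.msymm σ K μ =
      ∑ s : Sym σ d, MvPolynomial.C (c (Nat.Partition.ofSym s)) *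
        (s.1.map MvPolynomial.X).prod := by
  rw [← sum_fiberwise univ (fun s : Sym σ d => Nat.Partition.ofSym s)]
  refine sum_congr rfl fun μ _ => ?_
  rw [MvPolynomial.msymm, mul_sum]
  refine Eq.trans (sum_congr rfl fun s _ => ?_) (sum_subtype _ (fun s => by simp) _).symm
  rw [s.2]

theorem exists_monomial_expansion [DecidableEq σ] {f : MvPolynomial σ K} (hf : f.IsSymmetric)
    (hd : f.IsHomogeneous d) :
    ∃ c : Nat.Partition d → K, f = ∑ μ, MvPolynomial.C (c μ) * MvPolynomial.msymm σ K μ := by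
  have hconst : ∀ s s' : Sym σ d, Nat.Partition.ofSym s = Nat.Partition.ofSym s' →
      f.coeff (Multiset.toFinsupp s'.1) = f.coeff (Multiset.toFinsupp s.1) := by
    intro s s' h
    obtain ⟨e, he⟩ := exists_perm_map_eq_of_ofSym_eq h
    have hmap : Multiset.toFinsupp s'.1 = (Multiset.toFinsupp s.1).mapDomain e := by
      rw [he]
      apply (Multiset.toFinsupp (α := σ)).symm.injective
      change Finsupp.toMultiset _ = Finsupp.toMultiset _
      rw [← Finsupp.toMultiset_map]
      simp
    rw [hmap]
    conv_lhs => rw [← hf e]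
    exact MvPolynomial.coeff_rename_mapDomain e e.injective f _
  refine ⟨fun μ => if h : ∃ s : Sym σ d, Nat.Partition.ofSym s = μ then
    f.coeff (Multiset.toFinsupp h.choose.1) else 0, ?_⟩
  rw [sum_C_mul_msymm]
  have hc : ∀ s : Sym σ d, (if h : ∃ s' : Sym σ d,
      Nat.Partition.ofSym s' = Nat.Partition.ofSym s then
      f.coeff (Multiset.toFinsupp h.choose.1) else 0) = f.coeff (Multiset.toFinsupp s.1) := by
    intro s
    have h : ∃ s' : Sym σ d, Nat.Partition.ofSym s' = Nat.Partition.ofSym s := ⟨s, rfl⟩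
    rw [dif_pos h]
    exact hconst _ _ h.choose_spec.symm
  ext m
  simp only [hc, MvPolynomial.coeff_sum, prod_map_X, MvPolynomial.coeff_C_mul,
    MvPolynomial.coeff_monomial, mul_ite, mul_one, mul_zero]
  by_cases hm : m.degree = d
  · have hcard : (Finsupp.toMultiset m).card = d := by
      rw [Finsupp.card_toMultiset, ← hm]
      rfl
    rw [Fintype.sum_eq_single ⟨Finsupp.toMultiset m, hcard⟩]
    · simp
    · intro s hs
      rw [if_neg]
      intro h
      exact hs (Subtype.ext ((Multiset.toFinsupp_toMultiset s.1).symm.trans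
        (congrArg Finsupp.toMultiset h)))
  · rw [hd.coeff_eq_zero hm]
    symm
    refine sum_eq_zero fun s _ => if_neg fun h => hm ?_
    exact (congrArg Finsupp.degree h).symm.trans ((Multiset.toFinsupp_sum_eq s.1).trans s.2)

theorem isHomogeneous_psumPart (ν : Nat.Partition d) :
    (MvPolynomial.psumPart σ K ν).IsHomogeneous d := by
  have h : ∀ s : Multiset ℕ, (s.map (MvPolynomial.psum σ K)).prod.IsHomogeneous s.sum := by
    intro s
    induction s using Multiset.induction_on with
    | empty => simpa using MvPolynomial.isHomogeneous_one σ K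
    | cons j s ih =>
      rw [Multiset.map_cons, Multiset.prod_cons, Multiset.sum_cons]
      exact (MvPolynomial.IsHomogeneous.sum _ _ _ fun i _ =>
        MvPolynomial.isHomogeneous_X_pow i j).mul ih
  have := h ν.parts
  rwa [ν.parts_sum] at this

theorem isSymmetric_psumPart (ν : Nat.Partition d) :
    (MvPolynomial.psumPart σ K ν).IsSymmetric := by
  intro e
  rw [MvPolynomial.psumPart, map_multiset_prod, Multiset.map_map]
  simp only [Function.comp_def, MvPolynomial.rename_psum]

theorem exists_hasMonomialExpansion (a : Nat.Partition d → K) : ∃ c, HasMonomialExpansion a c := by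
  refine exists_monomial_expansion ?_ ?_
  · intro e
    simp only [symFun, map_sum, map_mul, MvPolynomial.rename_C, isSymmetric_psumPart _ e]
  · refine MvPolynomial.IsHomogeneous.sum _ _ _ fun ν _ => ?_
    simpa using (MvPolynomial.isHomogeneous_C (Fin d) (a ν)).mul (isHomogeneous_psumPart ν)

theorem eval_symFun (x : σ → K) (a : Nat.Partition d → K) :
    MvPolynomial.eval x (symFun σ a) =
      ∑ ν, a ν * (ν.parts.map fun j => ∑ i, x i ^ j).prod := by
  simp only [symFun, map_sum, map_mul, MvPolynomial.eval_C, MvPolynomial.psumPart,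
    map_multiset_prod, Multiset.map_map, Function.comp_def, MvPolynomial.psum, map_pow,
    MvPolynomial.eval_X]

/-- The coefficient of `m_{(d)}` in `∑_ν a_ν p_ν` is `∑_ν a_ν`. -/
theorem HasMonomialExpansion.apply_indiscrete {a c : Nat.Partition d → K}
    (h : HasMonomialExpansion a c) : c (Nat.Partition.indiscrete d) = ∑ ν, a ν := by
  rw [HasMonomialExpansion, sum_C_mul_msymm] at h
  cases d with
  | zero =>
    have h' := congrArg (MvPolynomial.eval fun _ => 0) h
    rw [eval_symFun] at h'
    have h1 : Nat.Partition.ofSym (default : Sym (Fin 0) 0) = Nat.Partition.indiscrete 0 :=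
      Subsingleton.elim _ _
    have h2 : ((default : Sym (Fin 0) 0) : Multiset (Fin 0)) = 0 :=
      Multiset.eq_zero_of_forall_notMem fun i => i.elim0
    simpa [h1, h2] using h'.symm
  | succ d =>
    have h' := congrArg (MvPolynomial.eval (Pi.single 0 1)) h
    rw [eval_symFun, map_sum] at h'
    have h1 : ∀ ν : Nat.Partition (d + 1), (ν.parts.map fun j =>
        ∑ i, (Pi.single 0 1 : Fin (d + 1) → K) i ^ j).prod = 1 := by
      intro ν
      refine Multiset.prod_eq_one fun y hy => ?_
      obtain ⟨j, hj, rfl⟩ := Multiset.mem_map.mp hy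
      rw [Fintype.sum_eq_single 0 fun i hi => by
        rw [Pi.single_eq_of_ne hi, zero_pow (ν.parts_pos hj).ne']]
      simp
    rw [Fintype.sum_eq_single (Sym.replicate (d + 1) 0)] at h'
    · have h2 : Nat.Partition.ofSym (Sym.replicate (d + 1) (0 : Fin (d + 1))) =
          Nat.Partition.indiscrete (d + 1) := by
        have h3 : (Multiset.replicate (d + 1) (0 : Fin (d + 1))).dedup = {0} := by
          rw [← Multiset.coe_replicate, Multiset.coe_dedup, List.replicate_dedup d.succ_ne_zero]
          rfl
        ext1
        rw [Nat.Partition.indiscrete_parts d.succ_ne_zero]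
        simp only [Nat.Partition.ofSym, Sym.replicate, h3, Multiset.map_singleton,
          Multiset.count_replicate_self]
      simp only [h1, mul_one, h2] at h'
      rw [h']
      simp [Sym.replicate]
    · intro s hs
      obtain ⟨i, hi, hi0⟩ : ∃ i ∈ s.1, i ≠ 0 := by
        by_contra! hall
        exact hs (Subtype.ext (Multiset.eq_replicate.mpr ⟨s.2, hall⟩))
      rw [map_mul, map_multiset_prod, Multiset.map_map]
      refine mul_eq_zero_of_right _ (Multiset.prod_eq_zero (Multiset.mem_map.mpr ⟨i, hi, ?_⟩))
      simp [hi0]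

end Monomial

/-! ### One-row Macdonald polynomials -/

section Macdonald

variable {K : Type} [Field K] {q t : K} {d : ℕ}

theorem dominated_indiscrete (μ : Nat.Partition d) : Dominated μ (Nat.Partition.indiscrete d) := by
  have hsum : (μ.parts.sort (· ≥ ·)).sum = d := by
    rw [← Multiset.sum_coe, Multiset.sort_eq, μ.parts_sum]
  have hle : ∀ i, ((μ.parts.sort (· ≥ ·)).take i).sum ≤ d := by
    intro i
    conv_rhs => rw [← hsum, ← List.sum_take_add_sum_drop _ i]
    exact Nat.le_add_right _ _
  intro i
  cases i with
  | zero => simp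
  | succ i =>
    refine (hle _).trans ?_
    rcases Nat.eq_zero_or_pos d with rfl | hd
    · exact Nat.zero_le _
    · rw [Nat.Partition.indiscrete_parts hd.ne', Multiset.sort_singleton]
      simp

theorem macInner_eq (q t : K) (a b : Nat.Partition d → K) :
    macInner q t a b = ∑ ν, a ν * b ν / partWeight (fun j => (1 - t ^ j) / (1 - q ^ j)) ν.parts := by
  refine sum_congr rfl fun ν _ => ?_
  rw [partWeight, div_div_eq_mul_div, mul_div_assoc, ← Nat.cast_prod]
  congr 1
  rw [zCard, div_eq_mul_inv]
  congr 1
  rw [← Multiset.prod_map_inv']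
  simp

theorem partWeight_ne_zero [CharZero K] {c : ℕ → K} (hc : ∀ j > 0, c j ≠ 0) (ν : Nat.Partition d) :
    partWeight c ν.parts ≠ 0 := by
  refine div_ne_zero (Multiset.prod_ne_zero fun h => ?_) (Nat.cast_ne_zero.mpr (zCard_pos ν).ne')
  obtain ⟨j, hj, h0⟩ := Multiset.mem_map.mp h
  exact hc j (ν.parts_pos hj) h0

theorem qPhi_ne_zero : qPhi q ≠ 0 := fun h => by
  have := constantCoeff_qPhi (q := q)
  rw [h] at this
  simp at this

theorem sum_partWeight [CharZero K] (hq : ∀ j > 0, q ^ j ≠ 1) (t : K) (d : ℕ) :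
    ∑ ν : Nat.Partition d, partWeight (fun j => (1 - t ^ j) / (1 - q ^ j)) ν.parts =
      qPoch q t d / qPoch q q d := by
  have h := partSeries_mul_prod_qPhi hq t (fun _ : Unit => (1 : K))
  simp only [univ_unique, prod_singleton, sum_singleton, one_pow, mul_one, PowerSeries.rescale_one,
    RingHom.id_apply] at h
  rw [← qBinomial hq] at h
  have := congrArg (PowerSeries.coeff d) (mul_right_cancel₀ qPhi_ne_zero h)
  simpa [partSeries] using this

theorem isMacdonald_indiscrete_iff [CharZero K] (hq : ∀ j > 0, q ^ j ≠ 1) (ht : ∀ j > 0, t ^ j ≠ 1)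
    (htq : qPoch q t d ≠ 0) (a : Nat.Partition d → K) :
    IsMacdonald q t (Nat.Partition.indiscrete d) a ↔
      ∀ ν, qPoch q t d / qPoch q q d * a ν =
        partWeight (fun j => (1 - t ^ j) / (1 - q ^ j)) ν.parts := by
  have hqq := qPoch_self_ne_zero hq d
  have hw : ∀ ν : Nat.Partition d, partWeight (fun j => (1 - t ^ j) / (1 - q ^ j)) ν.parts ≠ 0 :=
    partWeight_ne_zero fun j hj => div_ne_zero (sub_ne_zero.mpr (ht j hj).symm)
      (sub_ne_zero.mpr (hq j hj).symm)
  have hne : qPoch q t d / qPoch q q d ≠ 0 := div_ne_zero htq hqq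
  constructor
  · rintro ⟨⟨c, hc, hc1, -⟩, horth⟩
    have hsum : ∑ ν, a ν = 1 := by rw [← hc.apply_indiscrete, hc1]
    have hconst : ∀ ν μ : Nat.Partition d,
        a ν / partWeight (fun j => (1 - t ^ j) / (1 - q ^ j)) ν.parts =
        a μ / partWeight (fun j => (1 - t ^ j) / (1 - q ^ j)) μ.parts := by
      intro ν μ
      obtain ⟨c', hc'⟩ := exists_hasMonomialExpansion
        (Pi.single ν 1 - Pi.single μ 1 : Nat.Partition d → K)
      have h0 : c' (Nat.Partition.indiscrete d) = 0 := by
        rw [hc'.apply_indiscrete]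
        simp
      have := horth _ c' hc' fun κ hκ => ⟨dominated_indiscrete κ, fun h => hκ (by rw [h, h0])⟩
      rw [macInner_eq] at this
      simpa [mul_sub, sub_div, Pi.single_apply, ite_div, sub_eq_zero] using this
    intro ν
    have h1 : ∀ μ : Nat.Partition d,
        a μ = a ν / partWeight (fun j => (1 - t ^ j) / (1 - q ^ j)) ν.parts *
          partWeight (fun j => (1 - t ^ j) / (1 - q ^ j)) μ.parts := by
      intro μ
      rw [hconst ν μ, div_mul_cancel₀ _ (hw μ)]
    have h2 : a ν / partWeight (fun j => (1 - t ^ j) / (1 - q ^ j)) ν.parts *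
        (qPoch q t d / qPoch q q d) = 1 := by
      rw [← sum_partWeight hq, mul_sum]
      exact (sum_congr rfl fun μ _ => (h1 μ).symm).trans hsum
    have hν := hw ν
    rw [div_mul_eq_mul_div, div_eq_one_iff_eq hν] at h2
    rw [mul_comm, h2]
  · intro h
    have hsum : ∑ ν, a ν = 1 := by
      refine mul_left_cancel₀ hne ?_
      rw [mul_sum, mul_one, sum_congr rfl fun ν _ => h ν, sum_partWeight hq]
    obtain ⟨c, hc⟩ := exists_hasMonomialExpansion a
    refine ⟨⟨c, hc, by rw [hc.apply_indiscrete, hsum], fun μ _ => dominated_indiscrete μ⟩, ?_⟩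
    intro b c' hb hc'
    have h0 : ∑ ν, b ν = 0 := by
      rw [← hb.apply_indiscrete]
      by_contra hne0
      exact (hc' _ hne0).2 rfl
    rw [macInner_eq]
    refine mul_left_cancel₀ hne ?_
    rw [mul_zero, mul_sum, ← h0]
    refine sum_congr rfl fun ν _ => ?_
    rw [mul_div_assoc', ← mul_assoc, h, mul_div_cancel_left₀ _ (hw ν)]

/-- The generating function of the one-row Macdonald polynomials. -/
theorem eval_macdonaldP_indiscrete [CharZero K] (hq : ∀ j > 0, q ^ j ≠ 1)
    (ht : ∀ j > 0, t ^ j ≠ 1) (htq : qPoch q t d ≠ 0) {σ : Type} [Fintype σ] (x : σ → K) :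
    qPoch q t d / qPoch q q d *
        MvPolynomial.eval x (macdonaldP q t (Nat.Partition.indiscrete d) σ) =
      PowerSeries.coeff d
        (partSeries fun j => (1 - t ^ j) / (1 - q ^ j) * ∑ i, x i ^ j) := by
  classical
  have hne : qPoch q t d / qPoch q q d ≠ 0 := div_ne_zero htq (qPoch_self_ne_zero hq d)
  have hex : ∃ a : Nat.Partition d → K, IsMacdonald q t (Nat.Partition.indiscrete d) a :=
    ⟨fun ν => (qPoch q t d / qPoch q q d)⁻¹ *
      partWeight (fun j => (1 - t ^ j) / (1 - q ^ j)) ν.parts,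
      (isMacdonald_indiscrete_iff hq ht htq _).mpr fun ν => mul_inv_cancel_left₀ hne _⟩
  have hspec := (isMacdonald_indiscrete_iff hq ht htq _).mp hex.choose_spec
  rw [macdonaldP, dif_pos hex, eval_symFun, mul_sum, partSeries, PowerSeries.coeff_mk]
  refine sum_congr rfl fun ν _ => ?_
  rw [← mul_assoc, hspec, partWeight, partWeight, Multiset.prod_map_mul, div_mul_eq_mul_div]

end Macdonald

open Classical in
theorem FixedPoint.coeff_vertexFunction {I E : Type} [Fintype E] {src tgt : E → I} {F : Type}
    [Field F] {ħ : Fˣ} {R S : Type} [Fintype R] [Fintype S]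
    (p : FixedPoint src tgt F ħ R S) (q : Fˣ) {T : Type} [CommRing T] [Algebra F T]
    (τ : (R → Fˣ) → T) (m : I →₀ ℕ) :
    MvPowerSeries.coeff m (p.vertexFunction q τ) =
      ∑ d ∈ (Fintype.piFinset fun r : R => range (m (p.vtx r) + 1)) with
        (∀ i : I, ∑ r : R with p.vtx r = i, d r = m i),
      Phi q ((chr q - chr ħ) * (p.polarization (p.shift q d) - p.polarization p.x)) •
        τ (p.shift q d) := rfl

/-! ### Comparison of the insertions -/

open scoped RatFunc in
theorem expandU_algebraMap (c : Cqh) :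
    expandU (algebraMap Cqh Cqhu c) = HahnSeries.ofPowerSeries ℤ Cqh (PowerSeries.C c) := by
  rw [IsScalarTower.algebraMap_apply Cqh (Polynomial Cqh) Cqhu, expandU,
    ← IsScalarTower.algebraMap_apply (Polynomial Cqh) Cqhu (LaurentSeries Cqh)]
  simp

theorem expandU_X : expandU RatFunc.X = HahnSeries.ofPowerSeries ℤ Cqh PowerSeries.X := by
  rw [HahnSeries.ofPowerSeries_X]
  exact RatFunc.coe_X

theorem expandU_qPoch (a w : Cqh) (d : ℕ) :
    expandU (qPoch (algebraMap Cqh Cqhu qq)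
        (algebraMap Cqh Cqhu a * (uu * algebraMap Cqh Cqhu w)) d) =
      HahnSeries.ofPowerSeries ℤ Cqh (∏ i ∈ range d,
        (1 - PowerSeries.C (a * w * (qq : Cqh) ^ i) * PowerSeries.X)) := by
  rw [qPoch, map_prod, map_prod]
  refine prod_congr rfl fun i _ => ?_
  simp only [uu, Units.val_mk0, map_sub, map_one, map_mul, map_pow, expandU_algebraMap, expandU_X]
  ring

theorem prod_one_sub_C_mul_X_ne_zero {ι : Type} (s : Finset ι) (c : ι → Cqh) :
    ∏ i ∈ s, (1 - PowerSeries.C (c i) * PowerSeries.X) ≠ 0 := by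
  refine prod_ne_zero_iff.mpr fun i _ h => ?_
  have := congrArg PowerSeries.constantCoeff h
  simp at this

theorem rescale_qPhi_ne_zero (c : Cqh) : PowerSeries.rescale c (qPhi (qq : Cqh)) ≠ 0 := by
  intro h
  have := congrArg PowerSeries.constantCoeff h
  rw [constantCoeff_rescale_apply, ← PowerSeries.coeff_zero_eq_constantCoeff_apply,
    constantCoeff_qPhi] at this
  simp at this

section

variable {k n : ℕ} (hk : 1 ≤ k) (hkn : 2 * k ≤ n)

theorem descendant_eq_rescale (x : Box k n → Cqhˣ) :
    descendant k n hk hkn x = PowerSeries.rescale (hh : Cqh) (partSeries fun j =>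
      (1 - ((qq : Cqh) / hh) ^ j) / (1 - (qq : Cqh) ^ j) *
        ∑ r : {r : Box k n // content r = vertexNK k n hk hkn}, (x r.1 : Cqh) ^ j) := by
  ext d
  rw [descendant, PowerSeries.coeff_mk, PowerSeries.coeff_rescale,
    eval_macdonaldP_indiscrete (fun _ => qq_pow_ne_one) (fun _ => qq_div_hh_pow_ne_one), mul_comm]
  rw [qPoch, prod_ne_zero_iff]
  exact fun i _ => sub_ne_zero.mpr (qq_div_hh_mul_qq_pow_ne_one i).symm

theorem descendant_mul_prod (x : Box k n → Cqhˣ) :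
    descendant k n hk hkn x *
      ∏ r : Box k n with content r = vertexNK k n hk hkn,
        PowerSeries.rescale (hh * x r : Cqh) (qPhi (qq : Cqh)) =
      ∏ r : Box k n with content r = vertexNK k n hk hkn,
        PowerSeries.rescale (qq * x r : Cqh) (qPhi (qq : Cqh)) := by
  have h := congrArg (PowerSeries.rescale (hh : Cqh)) (partSeries_mul_prod_qPhi
    (fun _ => qq_pow_ne_one) ((qq : Cqh) / hh)
    fun r : {r : Box k n // content r = vertexNK k n hk hkn} => (x r.1 : Cqh))
  rw [map_mul, ← descendant_eq_rescale, map_prod, map_prod] at h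
  simp only [PowerSeries.rescale_rescale] at h
  have hS : ∀ r, r ∈ univ.filter (fun r : Box k n => content r = vertexNK k n hk hkn) ↔
      content r = vertexNK k n hk hkn := by simp
  rw [prod_subtype _ hS, prod_subtype _ hS]
  convert h using 3 with r _ r
  · ring_nf
  · have := hh.ne_zero
    congr 1
    field_simp

theorem prefactor_eq_prod :
    prefactor k = ∏ r : Box k n with content r = vertexNK k n hk hkn,
      (PowerSeries.rescale (hh * (lambdaPoint k n hk hkn).x r : Cqh) (qPhi (qq : Cqh)) *
        (PowerSeries.rescale (qq * (lambdaPoint k n hk hkn).x r : Cqh) (qPhi (qq : Cqh)))⁻¹) := by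
  have hx : ∀ r : Box k n, ((lambdaPoint k n hk hkn).x r : Cqh) = (hh : Cqh) ^ (r.2 : ℕ) := by
    simp [lambdaPoint, rectanglePoint]
  symm
  refine prod_bij (fun r _ => (r.2 : ℕ) + 1) ?_ ?_ ?_ ?_
  · intro r _
    have := r.2.2
    rw [mem_Icc]
    omega
  · intro r hr s hs hrs
    have hr' := congrArg Subtype.val (mem_filter.mp hr).2
    have hs' := congrArg Subtype.val (mem_filter.mp hs).2
    have := r.2.2
    simp only [content, vertexNK] at hr' hs'
    exact Prod.ext (Fin.ext (by omega)) (Fin.ext (by omega))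
  · intro i hi
    rw [mem_Icc] at hi
    refine ⟨(⟨n - 2 * k + (i - 1), by omega⟩, ⟨i - 1, by omega⟩), ?_, ?_⟩
    · rw [mem_filter]
      refine ⟨mem_univ _, Subtype.ext ?_⟩
      simp only [content, vertexNK]
      omega
    · simp only
      omega
  · intro r _
    rw [hx, phiU, phiU, Nat.add_sub_cancel, pow_succ']

theorem prefactor_mul_prod :
    prefactor k * ∏ r : Box k n with content r = vertexNK k n hk hkn,
      PowerSeries.rescale (qq * (lambdaPoint k n hk hkn).x r : Cqh) (qPhi (qq : Cqh)) =
    ∏ r : Box k n with content r = vertexNK k n hk hkn,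
      PowerSeries.rescale (hh * (lambdaPoint k n hk hkn).x r : Cqh) (qPhi (qq : Cqh)) := by
  rw [prefactor_eq_prod hk hkn, ← prod_mul_distrib]
  refine prod_congr rfl fun r _ => ?_
  rw [mul_assoc, PowerSeries.inv_mul_cancel, mul_one]
  rw [constantCoeff_rescale_apply, ← PowerSeries.coeff_zero_eq_constantCoeff_apply,
    constantCoeff_qPhi]
  exact one_ne_zero

theorem prefactor_mul_descendant_mul_prod (d : Box k n → ℕ) :
    prefactor k * descendant k n hk hkn ((lambdaPoint k n hk hkn).shift qq d) *
      ∏ r : Box k n with content r = vertexNK k n hk hkn, ∏ i ∈ range (d r),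
        (1 - PowerSeries.C ((qq : Cqh) * (lambdaPoint k n hk hkn).x r * (qq : Cqh) ^ i) *
          PowerSeries.X) =
      ∏ r : Box k n with content r = vertexNK k n hk hkn, ∏ i ∈ range (d r),
        (1 - PowerSeries.C ((hh : Cqh) * (lambdaPoint k n hk hkn).x r * (qq : Cqh) ^ i) *
          PowerSeries.X) := by
  have hshift : ∀ (a : Cqh) (r : Box k n), a * (lambdaPoint k n hk hkn).shift qq d r =
      a * (lambdaPoint k n hk hkn).x r * (qq : Cqh) ^ d r := by
    intro a r
    rw [FixedPoint.shift, Units.val_mul, Units.val_pow_eq_pow_val]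
    ring
  have hphi := fun a : Cqh => (prod_congr rfl fun r (_ : r ∈ univ.filter
    fun r : Box k n => content r = vertexNK k n hk hkn) => rescale_qPhi_eq_prod_mul
      (q := (qq : Cqh)) (fun _ => qq_pow_ne_one) (a * (lambdaPoint k n hk hkn).x r) (d r))
  have hdesc := descendant_mul_prod hk hkn ((lambdaPoint k n hk hkn).shift qq d)
  simp only [hshift] at hdesc
  have hpre := prefactor_mul_prod hk hkn
  rw [hphi, hphi, prod_mul_distrib, prod_mul_distrib] at hpre
  have hne : ∏ r : Box k n with content r = vertexNK k n hk hkn, PowerSeries.rescale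
      ((hh : Cqh) * (lambdaPoint k n hk hkn).x r * (qq : Cqh) ^ d r) (qPhi (qq : Cqh)) ≠ 0 :=
    prod_ne_zero_iff.mpr fun r _ => rescale_qPhi_ne_zero _
  refine mul_right_cancel₀ hne ?_
  rw [← hpre, ← hdesc]
  ring

theorem expandU_prod_qPoch_div (d : Box k n → ℕ) :
    expandU (∏ r : Box k n with content r = vertexNK k n hk hkn,
        (qPoch (algebraMap Cqh Cqhu qq) (algebraMap Cqh Cqhu hh *
            (uu * algebraMap Cqh Cqhu ((lambdaPoint k n hk hkn).x r))) (d r) /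
          qPoch (algebraMap Cqh Cqhu qq) (algebraMap Cqh Cqhu qq *
            (uu * algebraMap Cqh Cqhu ((lambdaPoint k n hk hkn).x r))) (d r))) =
      HahnSeries.ofPowerSeries ℤ Cqh (prefactor k *
        descendant k n hk hkn ((lambdaPoint k n hk hkn).shift qq d)) := by
  rw [prod_div_distrib, map_div₀, map_prod, map_prod]
  simp only [expandU_qPoch]
  rw [← map_prod, ← map_prod, div_eq_iff, ← map_mul, prefactor_mul_descendant_mul_prod]
  rw [Ne, map_eq_zero_iff _ HahnSeries.ofPowerSeries_injective]
  exact prod_ne_zero_iff.mpr fun r _ => prod_one_sub_C_mul_X_ne_zero _ _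

end

end QuiverVertex

end

open QuiverVertex
/-- Both sides are elements of `ℂ(q, ħ)((u))[[z]]`; the right-hand side comes from
`ℂ(q, ħ)[[u]][[z]] = ℂ(q, ħ)[[z, u]]`. -/
theorem mainTheorem4 (k n : ℕ) (hk : 1 ≤ k) (hkn : 2 * k ≤ n) :
    MvPowerSeries.map expandU (dualVertex k n hk hkn) =
      MvPowerSeries.map (HahnSeries.ofPowerSeries ℤ Cqh)
        (MvPowerSeries.C (prefactor k) * lambdaVertex k n hk hkn) := by
  ext1 m
  rw [MvPowerSeries.coeff_map, MvPowerSeries.coeff_map, MvPowerSeries.coeff_C_mul, dualVertex,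
    lambdaVertex, FixedPoint.coeff_vertexFunction, FixedPoint.coeff_vertexFunction, map_sum,
    mul_sum, map_sum]
  refine sum_congr rfl fun d _ => ?_
  rw [dualPoint_Phi, smul_eq_mul, mul_one, map_mul, expandU_prod_qPoch_div, expandU_algebraMap,
    ← map_mul, PowerSeries.smul_eq_C_mul, mul_left_comm]
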